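/- **Setting.** Risk types form an interval $\Theta=[\underline\theta,\bar\theta]$, $\underline\theta<\bar\theta$, with a continuous density $f:\Theta\to(0,\infty)$, $\int_\Theta f=1$, and distribution function $F$. Loss-related valuations lie in $B=[0,\bar b)$, $0<\bar b\le\infty$. A type $\theta$ draws her valuation from a cumulative distribution function $H_\theta:B\to[0,1]$ with $\sup_B H_\theta=1$ (and $H_\theta=1$ to the right of $B$). $H_\theta$ is increasing in $\theta$ for first-order stochastic dominance, i.e. $H_{\theta'}(b)\le H_\theta(b)$ for $\theta\le\theta'$; $H_\theta(b)$ is continuously differentiable in $\theta$ and in $b\in B$, with $h_\theta=\partial H_\theta/\partial b>0$ on $B$, and the cross partial $\partial^2H_\theta(b)/\partial b\,\partial\theta$ exists and is continuous on $\Theta\times B$. The distortion $g:[0,1]\to[0,1]$ is increasing (not necessarily strictly) and continuously differentiable, with $g(q)\le q$, $g(0)=0$, $g(1)=1$. The supply $S:\mathbb R_+\to\mathbb R_+$ is strictly increasing, continuously differentiable and unbounded, with $S(0)=0$. Uninsured agents face the service price $p+\beta$, $\beta\ge0$. Derivatives at endpoints are one-sided. Put $$J_1(\theta,b)=1-g(H_\theta(b))+\frac{1-F(\theta)}{f(\theta)}\,g'(H_\theta(b))\,\frac{\partial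 H_\theta(b)}{\partial\theta},\qquad J(\theta,b)=\frac{J_1(\theta,b)}{h_\theta(b)}+b-p-\frac{1-H_\theta(b)}{h_\theta(b)}.$$ For a measurable allocation $x:\Theta\times B\to[0,1]$ and a price $p\ge 0$, the demand for services is $$\mathcal D(x;p)=\int_\Theta\int_{B\cap[0,p]}x(\theta,b)h_\theta(b)\,db\,f(\theta)\,d\theta+\int_\Theta[1-H_\theta(p)]f(\theta)\,d\theta .$$ Let $p^N$ and $p^F$ denote the positive prices at which the market clears without coverage and with full coverage: $\mathcal D(0;p^N)=S(p^N)$ and $\mathcal D(1;p^F)=S(p^F)$. For $p\in[p^N,p^F]$ the insurer's profit is $$\Pi(p)=\max_x\ \int_\Theta\int_{B\cap[0,p]}x(\theta,b)\,J(\theta,b)\,h_\theta(b)\,db\,f(\theta)\,d\theta+K(p),$$ the maximum being over measurable $x:\Theta\times B\to[0,1]$ such that $x(\theta,\cdot)$ is non-decreasing for every $\theta$ and $\mathcal D(x;p)=S(p)$, where $$K(p)=\int_0^{p+\beta}[1-g(H_{\underline\theta}(b))]\,db-\int_0^{p}[1-g(H_{\underline\theta}(b))]\,db .$$ **Proposition.**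 Assume that $\beta=0$; that for every $\theta\in\Theta$, $J(\theta,\cdot)$ is strictly increasing on $B$ (a condition that does not depend on $p$), $J_1(\theta,\cdot)$ is non-increasing on $B$, and $H_\theta(\cdot)$ is affine on $B$; and that $S$ is affine on $\mathbb R_+$. Then $p^N$ and $p^F$ exist and are unique, $p^N<p^F$, and the maximum defining $\Pi(p)$ is attained for every $p\in[p^N,p^F]$. Moreover $\Pi$ is differentiable on $[p^N,p^F]$ (one-sidedly at the ends), its derivative $\Pi'$ is strictly decreasing on $[p^N,p^F]$, and $\Pi$ is concave on $[p^N,p^F]$. -/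

import Mathlib

open MeasureTheory Set

noncomputable section

/-- Primitives of the model: bounds of the interval of risk types, upper end of the interval of
loss-related valuations (possibly infinite), cumulative distribution functions `H θ` of valuations,
density `f` of risk types, probability distortion `g` of the dual utility, supply `S`, and the
surcharge `β` on the service price faced by uninsured agents. -/
structure InsuranceMarket where
  θlo : ℝ
  θhi : ℝ
  bbar : EReal
  H : ℝ → ℝ → ℝ
  f : ℝ → ℝ
  g : ℝ → ℝ
  S : ℝ → ℝ
  β : ℝ

namespace InsuranceMarket

variable (M : InsuranceMarket)

/-- Risk types `[θlo, θhi]`. -/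
def Θ : Set ℝ := Icc M.θlo M.θhi

/-- Valuations `[0, bbar)`. -/
def B : Set ℝ := {b : ℝ | 0 ≤ b ∧ (b : EReal) < M.bbar}

/-- Density of valuations: the derivative of `H θ` (one-sided at `0`). -/
def h (θ b : ℝ) : ℝ := derivWithin (M.H θ) M.B b

/-- Partial derivative of `H` in the risk type (one-sided at the ends of `Θ`). -/
def dHdθ (θ b : ℝ) : ℝ := derivWithin (fun t => M.H t b) M.Θ θ

/-- Cross partial derivative of `H`. -/
def d2H (θ b : ℝ) : ℝ := derivWithin (fun c => M.dHdθ θ c) M.B b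

/-- Derivative of the distortion on `[0, 1]`. -/
def g' (q : ℝ) : ℝ := derivWithin M.g (Icc 0 1) q

/-- Cumulative distribution function of risk types. -/
def F (θ : ℝ) : ℝ := ∫ t in M.θlo..θ, M.f t

/-- The standing assumptions on the primitives. -/
structure IsRegular : Prop where
  θ_lt : M.θlo < M.θhi
  bbar_pos : 0 < M.bbar
  f_cont : ContinuousOn M.f M.Θ
  f_pos : ∀ θ ∈ M.Θ, 0 < M.f θ
  f_prob : ∫ θ in M.θlo..M.θhi, M.f θ = 1
  H_mem : ∀ θ ∈ M.Θ, ∀ b ∈ M.B, M.H θ b ∈ Icc (0 : ℝ) 1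
  /-- `H θ` puts all its mass on `B` ... -/
  H_sup : ∀ θ ∈ M.Θ, IsLUB (M.H θ '' M.B) 1
  /-- ... and, as a cumulative distribution function, equals one to the right of `B`. -/
  H_right : ∀ θ ∈ M.Θ, ∀ b : ℝ, M.bbar ≤ (b : EReal) → M.H θ b = 1
  /-- Higher risk types have higher valuations in first-order stochastic dominance. -/
  H_fosd : ∀ θ ∈ M.Θ, ∀ θ' ∈ M.Θ, θ ≤ θ' → ∀ b ∈ M.B, M.H θ' b ≤ M.H θ b
  H_smooth_θ : ∀ b ∈ M.B, ContDiffOn ℝ 1 (fun θ => M.H θ b) M.Θ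
  H_smooth_b : ∀ θ ∈ M.Θ, ContDiffOn ℝ 1 (M.H θ) M.B
  h_pos : ∀ θ ∈ M.Θ, ∀ b ∈ M.B, 0 < M.h θ b
  H_cross : ∀ θ ∈ M.Θ, DifferentiableOn ℝ (fun b => M.dHdθ θ b) M.B
  H_cross_cont : ContinuousOn (fun z : ℝ × ℝ => M.d2H z.1 z.2) (M.Θ ×ˢ M.B)
  S_zero : M.S 0 = 0
  S_strictMono : StrictMonoOn M.S (Ici 0)
  S_smooth : ContDiffOn ℝ 1 M.S (Ici 0)
  S_unbdd : ¬ BddAbove (M.S '' Ici 0)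
  g_mono : MonotoneOn M.g (Icc 0 1)
  g_smooth : ContDiffOn ℝ 1 M.g (Icc 0 1)
  g_le : ∀ q ∈ Icc (0 : ℝ) 1, M.g q ≤ q
  g_zero : M.g 0 = 0
  g_one : M.g 1 = 1
  β_nonneg : 0 ≤ M.β

/-- Period-1 virtual value. -/
def J₁ (θ b : ℝ) : ℝ :=
  1 - M.g (M.H θ b) + (1 - M.F θ) / M.f θ * M.g' (M.H θ b) * M.dHdθ θ b

/-- Virtual value at service price `p`: period-1 virtual value over the density, plus period-2
virtual value. -/
def J (p θ b : ℝ) : ℝ :=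
  M.J₁ θ b * (1 / M.h θ b) + (b - p - (1 - M.H θ b) / M.h θ b)

/-- Certainty equivalent of type `θ` without insurance. -/
def UNP (p θ : ℝ) : ℝ := -∫ b in 0..(M.β + p), (1 - M.g (M.H θ b))

/-- The part of the profit that does not depend on the allocation. -/
def K (p : ℝ) : ℝ := -M.UNP p M.θlo - ∫ b in 0..p, (1 - M.g (M.H M.θlo b))

/-- Services demanded under the allocation `x` by agents with valuation at most `p`. -/
def insuredDemand (x : ℝ → ℝ → ℝ) (p : ℝ) : ℝ :=
  ∫ θ in M.θlo..M.θhi, (∫ b in M.B ∩ Icc 0 p, x θ b * M.h θ b) * M.f θ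

/-- Services demanded by agents with valuation above `p`. -/
def directDemand (p : ℝ) : ℝ := ∫ θ in M.θlo..M.θhi, (1 - M.H θ p) * M.f θ

/-- Total demand for services. -/
def demand (x : ℝ → ℝ → ℝ) (p : ℝ) : ℝ := M.insuredDemand x p + M.directDemand p

/-- Residual supply. -/
def RS (p : ℝ) : ℝ := M.S p - M.directDemand p

/-- `p` is a positive price that clears the market when nobody is covered. -/
def IsNoCoveragePrice (p : ℝ) : Prop := 0 < p ∧ M.demand (fun _ _ => 0) p = M.S p

/-- `p` is a positive price that clears the market when everybody is fully covered. -/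
def IsFullCoveragePrice (p : ℝ) : Prop := 0 < p ∧ M.demand (fun _ _ => 1) p = M.S p

/-- Allocations that are feasible in the first-stage problem at price `p`. -/
structure IsFeasible (p : ℝ) (x : ℝ → ℝ → ℝ) : Prop where
  meas : Measurable (fun z : ℝ × ℝ => x z.1 z.2)
  mem : ∀ θ ∈ M.Θ, ∀ b ∈ M.B, x θ b ∈ Icc (0 : ℝ) 1
  mono : ∀ θ ∈ M.Θ, MonotoneOn (x θ) M.B
  eq : M.insuredDemand x p = M.RS p

/-- The insurer's objective in the first-stage problem at price `p`. -/
def objective (p : ℝ) (x : ℝ → ℝ → ℝ) : ℝ :=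
  (∫ θ in M.θlo..M.θhi, (∫ b in M.B ∩ Icc 0 p, x θ b * M.J p θ b * M.h θ b) * M.f θ) + M.K p

/-- The profits that feasible allocations yield at price `p`. -/
def profitValues (p : ℝ) : Set ℝ := {v | ∃ x, M.IsFeasible p x ∧ v = M.objective p x}

/-- The insurer's profit: the value of the first-stage problem at price `p`. -/
def profit (p : ℝ) : ℝ := sSup (M.profitValues p)

end InsuranceMarket

/-- `φ` is affine on `s`. -/
def IsAffineOn (φ : ℝ → ℝ) (s : Set ℝ) : Prop := ∃ a c : ℝ, ∀ t ∈ s, φ t = a + c * t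

end

open Filter Topology

/-! The proof is Lagrangian duality in the market clearing constraint, followed by an envelope
argument. Affine distribution functions force `bbar` to be a finite `bb` and `H θ b = 1 - density *
(bb - b)`; supply is `s * p`. With `k` the joint density of types and valuations and `A = J₁ * f`,
the integrand of the objective is `x * (A + (2 * b - bb - p) * k)`, the constraint is linear in `x`,
and `K p = 0` because `β = 0`.

For a multiplier `l`, covering exactly the agents with `A + (2 * b - bb - l) * k ≥ 0` maximizes the
Lagrangian. This allocation is monotone because virtual values increase in `b`, and some `l` in
`[-bb, bb]` clears the market. Hence the profit is attained and equals the minimum over `l` of the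
dual function (`isGreatest_profitValues`).

Rewriting the positive part of the excess as a maximum puts the dual in a form whose derivative in
the price is `dualSlope`, weakly increasing in `-p` through `A` and strictly through `s`, and
strictly increasing in `l`. So the dual is concave in the price, and minimizing multipliers fall as
the price rises. A tie between two multipliers forces full coverage or no coverage, hence an extreme
price (`eq_or_eq_of_two_minimizers`). A suitable selection of minimizers is therefore continuous and
non-increasing, and `dualSlope` along it is a continuous, strictly decreasing supergradient of the
profit, hence its derivative. -/

/-! ### Differentiability from a continuous supergradient. -/

/-- A function with a continuous, strictly decreasing supergradient is differentiable and
concave, and the supergradient is its derivative. -/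
theorem differentiableOn_strictAntiOn_concaveOn_of_supergradient {V D : ℝ → ℝ} {u v : ℝ}
    (huv : u < v) (hsup : ∀ p ∈ Icc u v, ∀ q ∈ Icc u v, V q - V p ≤ D p * (q - p))
    (hcont : ContinuousOn D (Icc u v)) (hanti : StrictAntiOn D (Icc u v)) :
    DifferentiableOn ℝ V (Icc u v) ∧ StrictAntiOn (derivWithin V (Icc u v)) (Icc u v) ∧
      ConcaveOn ℝ (Icc u v) V := by
  have hder : ∀ p ∈ Icc u v, HasDerivWithinAt V (D p) (Icc u v) p := by
    intro p hp
    rw [hasDerivWithinAt_iff_isLittleO, Asymptotics.isLittleO_iff]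
    intro ε hε
    have h1 := Metric.continuousWithinAt_iff'.1 (hcont p hp) ε hε
    filter_upwards [h1, self_mem_nhdsWithin] with q hq hqS
    have h2 := hsup p hp q hqS
    have h3 := hsup q hqS p hp
    rw [Real.dist_eq] at hq
    simp only [smul_eq_mul, Real.norm_eq_abs]
    -- The supergradient inequalities at `p` and at `q` squeeze the remainder between `(D q - D p) *
    -- (q - p)` and zero.
    have h4 : |V q - V p - (q - p) * D p| ≤ |D q - D p| * |q - p| := by
      rw [← abs_mul, abs_le]
      constructor
      · nlinarith [neg_abs_le ((D q - D p) * (q - p))]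
      · nlinarith [abs_nonneg ((D q - D p) * (q - p))]
    exact h4.trans (mul_le_mul_of_nonneg_right hq.le (abs_nonneg _))
  have hdw : ∀ p ∈ Icc u v, derivWithin V (Icc u v) p = D p := fun p hp =>
    (hder p hp).derivWithin (uniqueDiffOn_Icc huv p hp)
  refine ⟨fun p hp => (hder p hp).differentiableWithinAt, ?_, convex_Icc u v, ?_⟩
  · intro p hp q hq hpq
    rw [hdw p hp, hdw q hq]
    exact hanti hp hq hpq
  · intro x hx y hy α γ hα hγ hαγ
    have hz : α • x + γ • y ∈ Icc u v := convex_Icc u v hx hy hα hγ hαγ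
    have h1 := mul_le_mul_of_nonneg_left (hsup _ hz x hx) hα
    have h2 := mul_le_mul_of_nonneg_left (hsup _ hz y hy) hγ
    simp only [smul_eq_mul] at *
    have e : α = 1 - γ := by linarith
    subst e
    nlinarith

/-! ### The dual function as a function of price and multiplier. -/

/-- Integral over types of the larger of the virtual value and its shadow price. -/
noncomputable def innerMax (a c bb : ℝ) (k : ℝ → ℝ) (A : ℝ → ℝ → ℝ) (q l : ℝ) : ℝ :=
  ∫ θ in a..c, max (A θ q) ((l + bb - 2 * q) * k θ)

/-- Lagrangian dual function of the allocation problem at price `p` and multiplier `l`. -/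
noncomputable def dual (a c bb s : ℝ) (k : ℝ → ℝ) (A : ℝ → ℝ → ℝ) (p l : ℝ) : ℝ :=
  -l * (∫ θ in a..c, k θ) * bb + s * l * p - s * p ^ 2 + ∫ q in 0..p, innerMax a c bb k A q l

/-- Derivative of the dual function in the price. -/
noncomputable def dualSlope (a c bb s : ℝ) (k : ℝ → ℝ) (A : ℝ → ℝ → ℝ) (q l : ℝ) : ℝ :=
  s * (l - 2 * q) + innerMax a c bb k A q l

section Dual

variable {a c bb s : ℝ} {k : ℝ → ℝ} {A : ℝ → ℝ → ℝ}

theorem continuous_innerMax (hk : Continuous k) (hA : Continuous fun z : ℝ × ℝ => A z.1 z.2) :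
    Continuous fun z : ℝ × ℝ => innerMax a c bb k A z.1 z.2 := by
  unfold innerMax
  apply intervalIntegral.continuous_parametric_intervalIntegral_of_continuous'
  have h1 : Continuous fun w : (ℝ × ℝ) × ℝ => A w.2 w.1.1 :=
    hA.comp (continuous_snd.prodMk continuous_fst.fst)
  exact h1.max (by fun_prop)

theorem continuous_innerMax_left (hk : Continuous k)
    (hA : Continuous fun z : ℝ × ℝ => A z.1 z.2) (l : ℝ) :
    Continuous fun q => innerMax a c bb k A q l :=
  (continuous_innerMax hk hA).comp (by fun_prop : Continuous fun q : ℝ => (q, l))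

theorem continuous_dual (hk : Continuous k) (hA : Continuous fun z : ℝ × ℝ => A z.1 z.2) :
    Continuous fun z : ℝ × ℝ => dual a c bb s k A z.1 z.2 := by
  unfold dual
  have h : Continuous fun z : ℝ × ℝ => ∫ q in (0 : ℝ)..z.1, innerMax a c bb k A q z.2 := by
    apply intervalIntegral.continuous_parametric_intervalIntegral_of_continuous _ continuous_fst
    exact (continuous_innerMax hk hA).comp
      (by fun_prop : Continuous fun w : (ℝ × ℝ) × ℝ => (w.2, w.1.2))
  fun_prop

theorem continuous_dualSlope (hk : Continuous k) (hA : Continuous fun z : ℝ × ℝ => A z.1 z.2) :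
    Continuous fun z : ℝ × ℝ => dualSlope a c bb s k A z.1 z.2 := by
  unfold dualSlope
  have := continuous_innerMax (a := a) (c := c) (bb := bb) hk hA
  fun_prop

theorem continuous_innerMax_integrand (hk : Continuous k)
    (hA : Continuous fun z : ℝ × ℝ => A z.1 z.2) (q l : ℝ) :
    Continuous fun θ => max (A θ q) ((l + bb - 2 * q) * k θ) := by
  have h1 : Continuous fun θ => A θ q := hA.comp (by fun_prop : Continuous fun θ : ℝ => (θ, q))
  fun_prop

theorem innerMax_le_innerMax (hac : a ≤ c) (hk : Continuous k)
    (hA : Continuous fun z : ℝ × ℝ => A z.1 z.2) (hkpos : ∀ θ ∈ Icc a c, 0 < k θ)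
    (hAanti : ∀ θ ∈ Icc a c, AntitoneOn (A θ) (Ici 0)) {p q l m : ℝ} (hp : 0 ≤ p) (hpq : p ≤ q)
    (hlm : m ≤ l) : innerMax a c bb k A q m ≤ innerMax a c bb k A p l := by
  apply intervalIntegral.integral_mono_on hac
    ((continuous_innerMax_integrand hk hA q m).intervalIntegrable _ _)
    ((continuous_innerMax_integrand hk hA p l).intervalIntegrable _ _)
  intro θ hθ
  exact max_le_max (hAanti θ hθ hp (hp.trans hpq) hpq)
    (mul_le_mul_of_nonneg_right (by linarith) (hkpos θ hθ).le)

theorem dual_sub_dual (hk : Continuous k) (hA : Continuous fun z : ℝ × ℝ => A z.1 z.2)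
    (p q l : ℝ) : dual a c bb s k A q l - dual a c bb s k A p l =
      ∫ t in p..q, dualSlope a c bb s k A t l := by
  have hG := continuous_innerMax_left (a := a) (c := c) (bb := bb) hk hA l
  have h1 : ∫ t in p..q, dualSlope a c bb s k A t l =
      (∫ t in p..q, s * (l - 2 * t)) + ∫ t in p..q, innerMax a c bb k A t l := by
    unfold dualSlope
    exact intervalIntegral.integral_add
      ((by fun_prop : Continuous fun t : ℝ => s * (l - 2 * t)).intervalIntegrable _ _)
      (hG.intervalIntegrable _ _)
  have h2 := intervalIntegral.integral_interval_sub_left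
    (hG.intervalIntegrable (μ := volume) 0 q) (hG.intervalIntegrable (μ := volume) 0 p)
  have h3 : ∫ t in p..q, s * (l - 2 * t) = s * l * (q - p) - s * (q ^ 2 - p ^ 2) := by
    rw [intervalIntegral.integral_const_mul, intervalIntegral.integral_sub (by simp)
      ((by fun_prop : Continuous fun t : ℝ => 2 * t).intervalIntegrable _ _),
      intervalIntegral.integral_const_mul, integral_id, intervalIntegral.integral_const, smul_eq_mul]
    ring
  rw [h1, h3, ← h2]
  unfold dual
  ring

/-- Concavity in the price: the slope is non-increasing because both `A` and `l + bb - 2 * q` are.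
Nonnegative prices are needed since `A` is monotone only there. -/
theorem dual_sub_dual_le (hac : a ≤ c) (hs : 0 < s) (hk : Continuous k)
    (hA : Continuous fun z : ℝ × ℝ => A z.1 z.2) (hkpos : ∀ θ ∈ Icc a c, 0 < k θ)
    (hAanti : ∀ θ ∈ Icc a c, AntitoneOn (A θ) (Ici 0)) {p q : ℝ} (hp : 0 ≤ p) (hq : 0 ≤ q)
    (l : ℝ) : dual a c bb s k A q l - dual a c bb s k A p l ≤
      dualSlope a c bb s k A p l * (q - p) := by
  have hc : Continuous fun t => dualSlope a c bb s k A t l :=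
    (continuous_dualSlope hk hA).comp (by fun_prop : Continuous fun q : ℝ => (q, l))
  have hanti : ∀ x y : ℝ, 0 ≤ x → x ≤ y →
      dualSlope a c bb s k A y l ≤ dualSlope a c bb s k A x l := by
    intro x y hx hxy
    have h1 := innerMax_le_innerMax (bb := bb) hac hk hA hkpos hAanti hx hxy (le_refl l)
    have h2 : s * (l - 2 * y) ≤ s * (l - 2 * x) := by gcongr
    unfold dualSlope
    linarith
  rcases le_total p q with hpq | hpq
  · rw [dual_sub_dual hk hA]
    have := intervalIntegral.integral_mono_on (μ := volume) hpq (hc.intervalIntegrable p q)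
      (intervalIntegrable_const (c := dualSlope a c bb s k A p l))
      (fun t ht => hanti p t hp ht.1)
    simpa [mul_comm] using this
  · have := intervalIntegral.integral_mono_on (μ := volume) hpq
      (intervalIntegrable_const (c := dualSlope a c bb s k A p l))
      (hc.intervalIntegrable q p) (fun t ht => hanti t p (hq.trans ht.1) ht.2)
    rw [← dual_sub_dual hk hA] at this
    simp only [intervalIntegral.integral_const, smul_eq_mul] at this
    linarith

/-- Multipliers that minimize the dual function at a higher price are lower. -/
theorem minimizer_le_minimizer (hac : a ≤ c) (hs : 0 < s) (hk : Continuous k)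
    (hA : Continuous fun z : ℝ × ℝ => A z.1 z.2) (hkpos : ∀ θ ∈ Icc a c, 0 < k θ)
    {p q l m : ℝ} (hpq : p < q)
    (hl : dual a c bb s k A p l ≤ dual a c bb s k A p m)
    (hm : dual a c bb s k A q m ≤ dual a c bb s k A q l) : m ≤ l := by
  by_contra! hlm
  have hc : ∀ l, Continuous fun t => dualSlope a c bb s k A t l := fun l =>
    (continuous_dualSlope hk hA).comp (by fun_prop : Continuous fun q : ℝ => (q, l))
  -- Increasing differences: a price rise adds strictly more to the dual at a larger multiplier, the
  -- strictness coming from the supply term. This contradicts the two minimality inequalities.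
  have hlt : ∀ t, dualSlope a c bb s k A t l < dualSlope a c bb s k A t m := by
    intro t
    have h1 : innerMax a c bb k A t l ≤ innerMax a c bb k A t m := by
      apply intervalIntegral.integral_mono_on hac
        ((continuous_innerMax_integrand hk hA t l).intervalIntegrable _ _)
        ((continuous_innerMax_integrand hk hA t m).intervalIntegrable _ _)
      intro θ hθ
      exact max_le_max le_rfl (mul_le_mul_of_nonneg_right (by linarith) (hkpos θ hθ).le)
    have h2 : s * (l - 2 * t) < s * (m - 2 * t) := by gcongr
    unfold dualSlope
    linarith
  have h := intervalIntegral.integral_lt_integral_of_continuousOn_of_le_of_exists_lt hpq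
    (hc l).continuousOn (hc m).continuousOn (fun t _ => (hlt t).le)
    ⟨p, left_mem_Icc.2 hpq.le, hlt p⟩
  rw [← dual_sub_dual hk hA, ← dual_sub_dual hk hA] at h
  linarith

/-- The dual function can have two minimizing multipliers only at the two extreme prices. -/
theorem eq_or_eq_of_two_minimizers (hac : a < c) (hk : Continuous k)
    (hA : Continuous fun z : ℝ × ℝ => A z.1 z.2) (hkpos : ∀ θ ∈ Icc a c, 0 < k θ)
    {p l m : ℝ} (hp : 0 < p) (hlm : l < m)
    (heq : dual a c bb s k A p l = dual a c bb s k A p m)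
    (hmid : dual a c bb s k A p l ≤ dual a c bb s k A p ((l + m) / 2)) :
    s * p = (∫ θ in a..c, k θ) * bb ∨ (s + ∫ θ in a..c, k θ) * p = (∫ θ in a..c, k θ) * bb := by
  set K := ∫ θ in a..c, k θ with hK
  have hG := continuous_innerMax_left (a := a) (c := c) (bb := bb) hk hA
  have hGi : ∀ l, IntervalIntegrable (fun q => innerMax a c bb k A q l) volume 0 p :=
    fun l => (hG l).intervalIntegrable _ _
  have hf := continuous_innerMax_integrand (bb := bb) hk hA
  have hfi : ∀ q l, IntervalIntegrable (fun θ => max (A θ q) ((l + bb - 2 * q) * k θ)) volume a c :=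
    fun q l => (hf q l).intervalIntegrable _ _
  -- Midpoint convexity in the multiplier. The two hypotheses on the dual make the integrated gap
  -- nonpositive, so by continuity the gap vanishes at every type and valuation.
  have hconv : ∀ θ ∈ Icc a c, ∀ q, 0 ≤ max (A θ q) ((l + bb - 2 * q) * k θ) +
      max (A θ q) ((m + bb - 2 * q) * k θ) - 2 * max (A θ q) (((l + m) / 2 + bb - 2 * q) * k θ) := by
    intro θ hθ q
    rcases max_cases (A θ q) (((l + m) / 2 + bb - 2 * q) * k θ) with h | h
    · rw [h.1]
      linarith [le_max_left (A θ q) ((l + bb - 2 * q) * k θ),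
        le_max_left (A θ q) ((m + bb - 2 * q) * k θ)]
    · rw [h.1]
      linarith [le_max_right (A θ q) ((l + bb - 2 * q) * k θ),
        le_max_right (A θ q) ((m + bb - 2 * q) * k θ)]
  have hinner : ∀ q, innerMax a c bb k A q l + innerMax a c bb k A q m -
      2 * innerMax a c bb k A q ((l + m) / 2) = ∫ θ in a..c, (max (A θ q) ((l + bb - 2 * q) * k θ) +
      max (A θ q) ((m + bb - 2 * q) * k θ) -
      2 * max (A θ q) (((l + m) / 2 + bb - 2 * q) * k θ)) := by
    intro q
    rw [intervalIntegral.integral_sub ((hfi q l).add (hfi q m)) ((hfi q _).const_mul 2),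
      intervalIntegral.integral_add (hfi q l) (hfi q m), intervalIntegral.integral_const_mul]
    rfl
  have hnonneg : ∀ q, 0 ≤ innerMax a c bb k A q l + innerMax a c bb k A q m -
      2 * innerMax a c bb k A q ((l + m) / 2) := by
    intro q
    rw [hinner]
    exact intervalIntegral.integral_nonneg hac.le fun θ hθ => hconv θ hθ q
  have htot : ∫ q in 0..p, (innerMax a c bb k A q l + innerMax a c bb k A q m -
      2 * innerMax a c bb k A q ((l + m) / 2)) ≤ 0 := by
    rw [intervalIntegral.integral_sub ((hGi l).add (hGi m)) ((hGi _).const_mul 2),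
      intervalIntegral.integral_add (hGi l) (hGi m), intervalIntegral.integral_const_mul]
    unfold dual at heq hmid
    linarith
  have hzero : ∀ θ ∈ Icc a c, ∀ q ∈ Icc 0 p, max (A θ q) ((l + bb - 2 * q) * k θ) +
      max (A θ q) ((m + bb - 2 * q) * k θ) -
        2 * max (A θ q) (((l + m) / 2 + bb - 2 * q) * k θ) ≤ 0 := by
    intro θ hθ q hq
    by_contra! hpos
    have h1 : 0 < innerMax a c bb k A q l + innerMax a c bb k A q m -
        2 * innerMax a c bb k A q ((l + m) / 2) := by
      rw [hinner]
      exact intervalIntegral.integral_pos hac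
        (((hf q l).add (hf q m)).sub ((hf q _).const_mul 2)).continuousOn
        (fun θ hθ => hconv θ (Ioc_subset_Icc_self hθ) q) ⟨θ, hθ, hpos⟩
    exact absurd htot (not_le.2 (intervalIntegral.integral_pos hp
      (((hG l).add (hG m)).sub ((hG _).const_mul 2)).continuousOn
      (fun q _ => hnonneg q) ⟨q, hq, h1⟩))
  -- The multiplier at which the two arguments of the maximum tie; in the market this is the virtual
  -- value at price zero.
  set ψ : ℝ × ℝ → ℝ := fun z => A z.1 z.2 / k z.1 - bb + 2 * z.2 with hψ
  have hψc : ContinuousOn ψ (Icc a c ×ˢ Icc 0 p) := by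
    apply ContinuousOn.add _ (by fun_prop)
    apply ContinuousOn.sub _ (by fun_prop)
    exact hA.continuousOn.div (by fun_prop) fun z hz => (hkpos z.1 hz.1).ne'
  have hpre : IsPreconnected (Icc a c ×ˢ Icc 0 p) := isPreconnected_Icc.prod isPreconnected_Icc
  have hψk : ∀ z ∈ Icc a c ×ˢ Icc 0 p, A z.1 z.2 = (ψ z + bb - 2 * z.2) * k z.1 := by
    intro z hz
    have := (hkpos z.1 hz.1).ne'
    simp only [hψ]
    field_simp
    ring
  -- A kink strictly between `l` and `m` would make the midpoint gap positive.
  have hout : ∀ z ∈ Icc a c ×ˢ Icc 0 p, ψ z ≤ l ∨ m ≤ ψ z := by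
    intro z hz
    by_contra! h
    have h1 := hzero z.1 hz.1 z.2 hz.2
    have hk0 := hkpos z.1 hz.1
    rw [hψk z hz, ← max_mul_of_nonneg _ _ hk0.le, ← max_mul_of_nonneg _ _ hk0.le,
      ← max_mul_of_nonneg _ _ hk0.le, max_eq_left (by linarith), max_eq_right (by linarith)] at h1
    rcases max_cases (ψ z + bb - 2 * z.2) ((l + m) / 2 + bb - 2 * z.2) with h2 | h2
    · rw [h2.1] at h1
      nlinarith
    · rw [h2.1] at h1
      nlinarith
  -- The rectangle is connected, so `ψ` cannot take values on both sides of the gap.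
  have hside : (∀ z ∈ Icc a c ×ˢ Icc 0 p, m ≤ ψ z) ∨ (∀ z ∈ Icc a c ×ˢ Icc 0 p, ψ z ≤ l) := by
    by_contra! h
    obtain ⟨⟨z, hz, hz1⟩, ⟨w, hw, hw1⟩⟩ := h
    have hz2 := (hout z hz).resolve_right (not_le.2 hz1)
    have hw2 := (hout w hw).resolve_left (not_le.2 hw1)
    obtain ⟨y, hy, hy1⟩ := hpre.intermediate_value hz hw hψc
      (⟨by linarith, by linarith⟩ : (l + m) / 2 ∈ Icc (ψ z) (ψ w))
    rcases hout y hy with h | h <;> linarith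
  -- If passing from `l` to `m` shifts `innerMax` by a constant, equality of the dual values is a
  -- linear equation for `p`. The shift is `0` when `A` is always the maximum (full coverage) and
  -- `(m - l) * K` when it never exceeds the other argument (no coverage).
  have hdiff : ∀ d, (∀ q ∈ Icc 0 p, innerMax a c bb k A q m = innerMax a c bb k A q l + d) →
      (m - l) * (s * p - K * bb) + p * d = 0 := by
    intro d hd
    have h1 : ∫ q in 0..p, innerMax a c bb k A q m =
        (∫ q in 0..p, innerMax a c bb k A q l) + p * d := by
      rw [intervalIntegral.integral_congr (g := fun q => innerMax a c bb k A q l + d)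
        (fun q hq => hd q (by rwa [uIcc_of_le hp.le] at hq)),
        intervalIntegral.integral_add (hGi l) (by simp)]
      simp
    unfold dual at heq
    rw [h1] at heq
    linarith
  rcases hside with h | h
  · left
    have h1 := hdiff 0 fun q hq => by
      rw [add_zero]
      apply intervalIntegral.integral_congr
      intro θ hθ
      rw [uIcc_of_le hac.le] at hθ
      have hz : (θ, q) ∈ Icc a c ×ˢ Icc 0 p := ⟨hθ, hq⟩
      have hk0 := hkpos θ hθ
      have h2 := h _ hz
      have h3 := hψk _ hz
      simp only at h3 ⊢
      rw [h3, max_eq_left, max_eq_left]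
      · exact mul_le_mul_of_nonneg_right (by linarith) hk0.le
      · exact mul_le_mul_of_nonneg_right (by linarith) hk0.le
    have h2 : (m - l) * (s * p - K * bb) = 0 := by linarith
    rcases mul_eq_zero.1 h2 with h3 | h3 <;> linarith
  · right
    have h1 := hdiff ((m - l) * K) fun q hq => by
      rw [hK, ← intervalIntegral.integral_const_mul]
      unfold innerMax
      rw [← intervalIntegral.integral_add (hfi q l) ((hk.intervalIntegrable _ _).const_mul _)]
      apply intervalIntegral.integral_congr
      intro θ hθ
      rw [uIcc_of_le hac.le] at hθ
      have hz : (θ, q) ∈ Icc a c ×ˢ Icc 0 p := ⟨hθ, hq⟩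
      have hk0 := hkpos θ hθ
      have h2 := h _ hz
      have h3 := hψk _ hz
      simp only at h3 ⊢
      rw [h3, max_eq_right, max_eq_right]
      · ring
      · exact mul_le_mul_of_nonneg_right (by linarith) hk0.le
      · exact mul_le_mul_of_nonneg_right (by linarith) hk0.le
    have h2 : (m - l) * (s * p - K * bb + p * K) = 0 := by linarith
    rcases mul_eq_zero.1 h2 with h3 | h3 <;> linarith

/-- A function which is the minimum of the dual function over multipliers in a compact interval is
differentiable with strictly decreasing derivative, and concave. -/
theorem differentiableOn_strictAntiOn_concaveOn_of_dual {lo hi u v : ℝ} {V : ℝ → ℝ}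
    (hac : a < c) (hs : 0 < s) (hk : Continuous k)
    (hA : Continuous fun z : ℝ × ℝ => A z.1 z.2) (hkpos : ∀ θ ∈ Icc a c, 0 < k θ)
    (hAanti : ∀ θ ∈ Icc a c, AntitoneOn (A θ) (Ici 0)) (hu0 : 0 < u) (huv : u < v)
    (hu : (s + ∫ θ in a..c, k θ) * u = (∫ θ in a..c, k θ) * bb)
    (hv : s * v = (∫ θ in a..c, k θ) * bb)
    (hle : ∀ p ∈ Icc u v, ∀ l ∈ Icc lo hi, V p ≤ dual a c bb s k A p l)
    (hex : ∀ p ∈ Icc u v, ∃ l ∈ Icc lo hi, V p = dual a c bb s k A p l) :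
    DifferentiableOn ℝ V (Icc u v) ∧ StrictAntiOn (derivWithin V (Icc u v)) (Icc u v) ∧
      ConcaveOn ℝ (Icc u v) V := by
  have hKpos : 0 < ∫ θ in a..c, k θ :=
    intervalIntegral.intervalIntegral_pos_of_pos_on (hk.intervalIntegrable _ _)
      (fun θ hθ => hkpos θ (Ioo_subset_Icc_self hθ)) hac
  have hdc := continuous_dual (a := a) (c := c) (bb := bb) (s := s) hk hA
  set Λ : ℝ → Set ℝ := fun p => {l ∈ Icc lo hi | dual a c bb s k A p l = V p} with hΛ
  have hcomp : ∀ p, IsCompact (Λ p) := fun p =>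
    isCompact_Icc.inter_right (isClosed_eq
      (hdc.comp (by fun_prop : Continuous fun l : ℝ => (p, l))) continuous_const)
  have hne : ∀ p ∈ Icc u v, (Λ p).Nonempty := fun p hp => by
    obtain ⟨l, hl, h⟩ := hex p hp
    exact ⟨l, hl, h.symm⟩
  have hanti : ∀ p ∈ Icc u v, ∀ q ∈ Icc u v, p < q → ∀ l ∈ Λ p, ∀ m ∈ Λ q, m ≤ l := by
    intro p hp q hq hpq l hl m hm
    exact minimizer_le_minimizer hac.le hs hk hA hkpos hpq (hl.2.trans_le (hle p hp m hm.1))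
      (hm.2.trans_le (hle q hq l hl.1))
  have huniq : ∀ p ∈ Ioo u v, ∀ l ∈ Λ p, ∀ m ∈ Λ p, l = m := by
    have key : ∀ p ∈ Ioo u v, ∀ l ∈ Λ p, ∀ m ∈ Λ p, ¬ l < m := by
      intro p hp l hl m hm hlm
      have hmid : (l + m) / 2 ∈ Icc lo hi :=
        ⟨by linarith [hl.1.1, hm.1.1], by linarith [hl.1.2, hm.1.2]⟩
      rcases eq_or_eq_of_two_minimizers hac hk hA hkpos (hu0.trans hp.1) hlm
        (hl.2.trans hm.2.symm) (hl.2.trans_le (hle p (Ioo_subset_Icc_self hp) _ hmid)) with h | h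
      · have := mul_lt_mul_of_pos_left hp.2 hs
        linarith
      · have := mul_lt_mul_of_pos_left hp.1 (add_pos hs hKpos)
        linarith
    exact fun p hp l hl m hm =>
      le_antisymm (not_lt.1 (key p hp m hm l hl)) (not_lt.1 (key p hp l hl m hm))
  -- Only the two ends can have several minimizers. Monotonicity makes the least one the limit at
  -- `u` and the greatest one the limit at `v`.
  set lam : ℝ → ℝ := fun p => if p < v then sInf (Λ p) else sSup (Λ p) with hlam
  have hmem : ∀ p ∈ Icc u v, lam p ∈ Λ p := by
    intro p hp
    simp only [hlam]
    split_ifs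
    · exact (hcomp p).sInf_mem (hne p hp)
    · exact (hcomp p).sSup_mem (hne p hp)
  -- Minimizers have a closed graph, so every cluster point of `lam` at `p` is a minimizer at `p`;
  -- compactness then turns uniqueness of the cluster point into convergence.
  have hclosed : IsClosed {z : ℝ × ℝ | ∀ l ∈ Icc lo hi, dual a c bb s k A z.1 z.2 ≤
      dual a c bb s k A z.1 l} := by
    simp only [ofPred_forall]
    refine isClosed_iInter fun l => isClosed_iInter fun _ => isClosed_le hdc ?_
    exact hdc.comp (by fun_prop : Continuous fun z : ℝ × ℝ => (z.1, l))
  have hlamc : ∀ p ∈ Icc u v, Tendsto lam (𝓝[Icc u v \ {p}] p) (𝓝 (lam p)) := by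
    intro p hp
    have hSev : ∀ᶠ q in 𝓝[Icc u v \ {p}] p, q ∈ Icc u v \ {p} := self_mem_nhdsWithin
    refine isCompact_Icc.tendsto_nhds_of_unique_mapClusterPt (hSev.mono fun q hq =>
      (hmem q hq.1).1) ?_
    intro y hy hcl
    have hyΛ : y ∈ Λ p := by
      obtain ⟨U, hU, hUy⟩ := mapClusterPt_iff_ultrafilter.1 hcl
      have h1 : Tendsto (fun q => (q, lam q)) U (𝓝 (p, y)) :=
        (tendsto_id.mono_left (hU.trans nhdsWithin_le_nhds)).prodMk_nhds hUy
      have h2 : (p, y) ∈ {z : ℝ × ℝ | ∀ l ∈ Icc lo hi, dual a c bb s k A z.1 z.2 ≤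
          dual a c bb s k A z.1 l} := by
        apply hclosed.mem_of_tendsto h1
        filter_upwards [hSev.filter_mono hU] with q hq l hl
        exact (hmem q hq.1).2.trans_le (hle q hq.1 l hl)
      exact ⟨hy, le_antisymm ((h2 _ (hmem p hp).1).trans_eq (hmem p hp).2) (hle p hp y hy)⟩
    rcases eq_or_lt_of_le hp.1 with h | h
    · subst h
      refine le_antisymm ?_ ?_
      · refine isClosed_Iic.mem_of_mapClusterPt hcl (s := Iic (lam u)) ?_
        filter_upwards [hSev] with q hq
        exact hanti u hp q hq.1 (lt_of_le_of_ne hq.1.1 (Ne.symm hq.2)) _ (hmem u hp) _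
          (hmem q hq.1)
      · simp only [hlam, if_pos huv]
        exact csInf_le (hcomp u).bddBelow hyΛ
    rcases eq_or_lt_of_le hp.2 with h' | h'
    · subst h'
      refine le_antisymm ?_ ?_
      · simp only [hlam, if_neg (lt_irrefl _)]
        exact le_csSup (hcomp p).bddAbove hyΛ
      · refine isClosed_Ici.mem_of_mapClusterPt hcl (s := Ici (lam p)) ?_
        filter_upwards [hSev] with q hq
        exact hanti q hq.1 p hp (lt_of_le_of_ne hq.1.2 hq.2) _ (hmem q hq.1) _ (hmem p hp)
    · exact huniq p ⟨h, h'⟩ _ hyΛ _ (hmem p hp)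
  have hlamcont : ContinuousOn lam (Icc u v) := by
    intro p hp
    exact continuousWithinAt_sdiff_self.1 (hlamc p hp)
  refine differentiableOn_strictAntiOn_concaveOn_of_supergradient
    (D := fun p => dualSlope a c bb s k A p (lam p)) huv ?_ ?_ ?_
  -- Envelope inequality: the multiplier optimal at `p` still bounds `V q` from above.
  · intro p hp q hq
    have h1 := dual_sub_dual_le (bb := bb) hac.le hs hk hA hkpos hAanti (hu0.le.trans hp.1)
      (hu0.le.trans hq.1) (lam p)
    rw [(hmem p hp).2] at h1
    linarith [hle q hq _ (hmem p hp).1]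
  · exact (continuous_dualSlope hk hA).comp_continuousOn (continuousOn_id.prodMk hlamcont)
  · intro p hp q hq hpq
    have h1 := hanti p hp q hq hpq _ (hmem p hp) _ (hmem q hq)
    have h2 := innerMax_le_innerMax (bb := bb) hac.le hk hA hkpos hAanti (hu0.le.trans hp.1)
      hpq.le h1
    have h3 : s * (lam q - 2 * q) < s * (lam p - 2 * p) :=
      mul_lt_mul_of_pos_left (by linarith) hs
    simp only [dualSlope]
    linarith

end Dual

/-! ### Lagrangian duality at a fixed price. -/

/-- Weighted virtual value net of the multiplier `l`. -/
def excess (bb : ℝ) (k : ℝ → ℝ) (A : ℝ → ℝ → ℝ) (l : ℝ) (z : ℝ × ℝ) : ℝ :=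
  A z.1 z.2 + (2 * z.2 - bb - l) * k z.1

/-- Types and valuations of the agents who may be covered at price `p`. -/
def coverable (a c bb p : ℝ) : Set (ℝ × ℝ) := Ioc a c ×ˢ Ioo 0 (min p bb)

open Classical in
/-- Allocation that covers the agents whose virtual value is at least `l`. -/
noncomputable def threshold (bb : ℝ) (k : ℝ → ℝ) (A : ℝ → ℝ → ℝ) (l : ℝ) (z : ℝ × ℝ) : ℝ :=
  if 0 ≤ excess bb k A l z then 1 else 0

section Duality

variable {a c bb s p : ℝ} {k : ℝ → ℝ} {A : ℝ → ℝ → ℝ}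

theorem measurableSet_coverable : MeasurableSet (coverable a c bb p) :=
  measurableSet_Ioc.prod measurableSet_Ioo

theorem Continuous.integrableOn_coverable {w : ℝ × ℝ → ℝ} (hw : Continuous w) :
    IntegrableOn w (coverable a c bb p) :=
  (hw.continuousOn.integrableOn_compact
    (isCompact_Icc.prod isCompact_Icc : IsCompact (Icc a c ×ˢ Icc 0 (min p bb)))).mono_set
    (prod_mono Ioc_subset_Icc_self Ioo_subset_Icc_self)

theorem integrableOn_coverable_mul {w X : ℝ × ℝ → ℝ} (hw : Continuous w) (hX : Measurable X)
    (hX01 : ∀ z ∈ coverable a c bb p, X z ∈ Icc (0 : ℝ) 1) :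
    IntegrableOn (fun z => X z * w z) (coverable a c bb p) := by
  apply Integrable.bdd_mul (c := 1) hw.integrableOn_coverable hX.aestronglyMeasurable
  filter_upwards [ae_restrict_mem measurableSet_coverable] with z hz
  rw [Real.norm_eq_abs, abs_of_nonneg (hX01 z hz).1]
  exact (hX01 z hz).2

theorem setIntegral_coverable {w : ℝ × ℝ → ℝ} (hac : a ≤ c)
    (hw : IntegrableOn w (coverable a c bb p)) :
    ∫ z in coverable a c bb p, w z = ∫ θ in a..c, ∫ b in Ioo 0 (min p bb), w (θ, b) := by
  rw [intervalIntegral.integral_of_le hac]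
  exact setIntegral_prod w hw

theorem setIntegral_coverable_fst (hac : a ≤ c) (hbb : 0 < bb) (hp : 0 ≤ p) (hk : Continuous k) :
    ∫ z in coverable a c bb p, k z.1 = (∫ θ in a..c, k θ) * min p bb := by
  rw [setIntegral_coverable hac (Continuous.integrableOn_coverable (by fun_prop))]
  simp [le_min hp hbb.le, mul_comm]

theorem continuous_excess (hk : Continuous k) (hA : Continuous fun z : ℝ × ℝ => A z.1 z.2)
    (l : ℝ) : Continuous (excess bb k A l) := by
  unfold excess
  fun_prop

theorem measurable_threshold (hk : Continuous k) (hA : Continuous fun z : ℝ × ℝ => A z.1 z.2)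
    (l : ℝ) : Measurable (threshold bb k A l) :=
  Measurable.ite (measurableSet_le measurable_const (continuous_excess hk hA l).measurable)
    measurable_const measurable_const

theorem threshold_mem (l : ℝ) (z : ℝ × ℝ) : threshold bb k A l z ∈ Icc (0 : ℝ) 1 := by
  unfold threshold
  split_ifs <;> simp

/-- The dual function as total positive excess plus the value of the market clearing constraint. -/
theorem dual_eq (hac : a ≤ c) (hbb : 0 < bb) (hk : Continuous k)
    (hA : Continuous fun z : ℝ × ℝ => A z.1 z.2) (hkpos : ∀ θ ∈ Icc a c, 0 < k θ)
    (hA0 : ∀ θ ∈ Icc a c, ∀ b, bb ≤ b → A θ b = 0) (hp : 0 ≤ p) {l : ℝ} (hl : l ≤ bb) :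
    dual a c bb s k A p l = (∫ z in coverable a c bb p, max (excess bb k A l z) 0) +
      (l - p) * (s * p - (∫ θ in a..c, k θ) * max (bb - p) 0) := by
  set K := ∫ θ in a..c, k θ with hK
  set m := min p bb with hm
  have hm0 : 0 ≤ m := le_min hp hbb.le
  have hG := continuous_innerMax_left (a := a) (c := c) (bb := bb) hk hA l
  have hec := (continuous_excess (bb := bb) hk hA l).max (continuous_const (y := (0 : ℝ)))
  have hE : Continuous fun q => ∫ θ in a..c, max (excess bb k A l (θ, q)) 0 := by
    apply intervalIntegral.continuous_parametric_intervalIntegral_of_continuous'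
    exact hec.comp continuous_swap
  -- `max (A, y) = max (A - y, 0) + y` with `y = (l + bb - 2 * q) * k`, where `A - y` is the excess.
  have h1 : ∀ q, innerMax a c bb k A q l =
      (∫ θ in a..c, max (excess bb k A l (θ, q)) 0) + (l + bb - 2 * q) * K := by
    intro q
    rw [hK, ← intervalIntegral.integral_const_mul, ← intervalIntegral.integral_add]
    · apply intervalIntegral.integral_congr
      intro θ _
      simp only [excess]
      rw [← max_add_add_right]
      congr 1 <;> ring
    · exact (hec.comp (by fun_prop : Continuous fun θ : ℝ => (θ, q))).intervalIntegrable _ _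
    · exact (hk.intervalIntegrable _ _).const_mul _
  -- Beyond `bb` there are no agents: `A` vanishes and, since `l ≤ bb`, the other argument is
  -- nonpositive. Prices above `bb` thus need no separate dual.
  have h2 : ∫ q in m..p, innerMax a c bb k A q l = 0 := by
    rcases le_total p bb with h | h
    · rw [hm, min_eq_left h, intervalIntegral.integral_same]
    · rw [intervalIntegral.integral_congr (g := fun _ => (0 : ℝ)), intervalIntegral.integral_zero]
      intro q hq
      rw [uIcc_of_le (min_le_left p bb), min_eq_right h] at hq
      simp only [innerMax]
      rw [intervalIntegral.integral_congr (g := fun _ => (0 : ℝ)), intervalIntegral.integral_zero]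
      intro θ hθ
      rw [uIcc_of_le hac] at hθ
      simp only
      rw [hA0 θ hθ q hq.1, max_eq_left]
      exact mul_nonpos_of_nonpos_of_nonneg (by linarith [hq.1]) (hkpos θ hθ).le
  have h3 : ∫ q in 0..m, innerMax a c bb k A q l =
      (∫ z in coverable a c bb p, max (excess bb k A l z) 0) + K * ((l + bb) * m - m ^ 2) := by
    rw [intervalIntegral.integral_congr (fun q _ => h1 q), intervalIntegral.integral_add
      (hE.intervalIntegrable _ _)
      ((by fun_prop : Continuous fun q : ℝ => (l + bb - 2 * q) * K).intervalIntegrable _ _),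
      setIntegral_coverable hac hec.integrableOn_coverable,
      intervalIntegral_intervalIntegral_swap]
    · congr 1
      · apply intervalIntegral.integral_congr
        intro θ _
        simp only
        rw [intervalIntegral.integral_of_le hm0, integral_Ioc_eq_integral_Ioo]
      · rw [intervalIntegral.integral_mul_const, intervalIntegral.integral_sub (by simp)
          ((by fun_prop : Continuous fun t : ℝ => 2 * t).intervalIntegrable _ _),
          intervalIntegral.integral_const_mul, integral_id, intervalIntegral.integral_const,
          smul_eq_mul]
        ring
    · have : Continuous (Function.uncurry fun q θ => max (excess bb k A l (θ, q)) 0) :=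
        hec.comp continuous_swap
      exact (this.continuousOn.integrableOn_compact
        (isCompact_uIcc.prod isCompact_uIcc : IsCompact (uIcc 0 m ×ˢ uIcc a c))).mono_set
        (prod_mono uIoc_subset_uIcc uIoc_subset_uIcc)
  have h4 := intervalIntegral.integral_add_adjacent_intervals
    (hG.intervalIntegrable (μ := volume) 0 m) (hG.intervalIntegrable (μ := volume) m p)
  rw [h2, h3, add_zero] at h4
  unfold dual
  rw [← h4]
  rcases le_total p bb with h | h
  · rw [max_eq_left (by linarith), hm, min_eq_left h]
    ring
  · rw [max_eq_right (by linarith), hm, min_eq_right h]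
    ring

theorem setIntegral_coverable_mul_excess (hk : Continuous k)
    (hA : Continuous fun z : ℝ × ℝ => A z.1 z.2) {X : ℝ × ℝ → ℝ} (hX : Measurable X)
    (hX01 : ∀ z ∈ coverable a c bb p, X z ∈ Icc (0 : ℝ) 1) (l : ℝ) :
    ∫ z in coverable a c bb p, X z * excess bb k A p z =
      (∫ z in coverable a c bb p, X z * excess bb k A l z) +
        (l - p) * ∫ z in coverable a c bb p, X z * k z.1 := by
  rw [← integral_const_mul, ← integral_add
    (integrableOn_coverable_mul (continuous_excess hk hA l) hX hX01)
    ((integrableOn_coverable_mul (by fun_prop) hX hX01).const_mul _)]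
  congr 1 with z
  simp only [excess]
  ring

/-- Weak duality. -/
theorem setIntegral_coverable_le_dual (hac : a ≤ c) (hbb : 0 < bb) (hk : Continuous k)
    (hA : Continuous fun z : ℝ × ℝ => A z.1 z.2) (hkpos : ∀ θ ∈ Icc a c, 0 < k θ)
    (hA0 : ∀ θ ∈ Icc a c, ∀ b, bb ≤ b → A θ b = 0) (hp : 0 ≤ p) {l : ℝ} (hl : l ≤ bb)
    {X : ℝ × ℝ → ℝ} (hX : Measurable X)
    (hX01 : ∀ z ∈ coverable a c bb p, X z ∈ Icc (0 : ℝ) 1)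
    (hXk : ∫ z in coverable a c bb p, X z * k z.1 =
      s * p - (∫ θ in a..c, k θ) * max (bb - p) 0) :
    ∫ z in coverable a c bb p, X z * excess bb k A p z ≤ dual a c bb s k A p l := by
  rw [dual_eq hac hbb hk hA hkpos hA0 hp hl, setIntegral_coverable_mul_excess hk hA hX hX01 l, hXk]
  apply add_le_add _ le_rfl
  have hec := continuous_excess (bb := bb) hk hA l
  apply setIntegral_mono_on (integrableOn_coverable_mul hec hX hX01)
    (hec.max continuous_const).integrableOn_coverable measurableSet_coverable
  intro z hz
  calc X z * excess bb k A l z ≤ X z * max (excess bb k A l z) 0 :=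
        mul_le_mul_of_nonneg_left (le_max_left _ _) (hX01 z hz).1
    _ ≤ 1 * max (excess bb k A l z) 0 :=
        mul_le_mul_of_nonneg_right (hX01 z hz).2 (le_max_right _ _)
    _ = _ := one_mul _

/-- Threshold allocations that clear the market attain the dual function. -/
theorem setIntegral_coverable_threshold_eq_dual (hac : a ≤ c) (hbb : 0 < bb) (hk : Continuous k)
    (hA : Continuous fun z : ℝ × ℝ => A z.1 z.2) (hkpos : ∀ θ ∈ Icc a c, 0 < k θ)
    (hA0 : ∀ θ ∈ Icc a c, ∀ b, bb ≤ b → A θ b = 0) (hp : 0 ≤ p) {l : ℝ} (hl : l ≤ bb)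
    (hXk : ∫ z in coverable a c bb p, threshold bb k A l z * k z.1 =
      s * p - (∫ θ in a..c, k θ) * max (bb - p) 0) :
    ∫ z in coverable a c bb p, threshold bb k A l z * excess bb k A p z =
      dual a c bb s k A p l := by
  rw [dual_eq hac hbb hk hA hkpos hA0 hp hl, setIntegral_coverable_mul_excess hk hA
    (measurable_threshold hk hA l) (fun z _ => threshold_mem l z) l, hXk]
  congr 2 with z
  unfold threshold
  split_ifs with h
  · rw [one_mul, max_eq_left h]
  · rw [zero_mul, max_eq_right (not_le.1 h).le]

/-- Dominated convergence: the threshold is locally constant in `l` wherever the excess is nonzero,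
and strict monotonicity in the valuation leaves at most one zero per type. -/
theorem continuous_setIntegral_threshold (hk : Continuous k)
    (hA : Continuous fun z : ℝ × ℝ => A z.1 z.2)
    (hAmono : ∀ θ ∈ Icc a c, StrictMonoOn (fun b => A θ b + 2 * b * k θ) (Ico 0 bb)) :
    Continuous fun l => ∫ z in coverable a c bb p, threshold bb k A l z * k z.1 := by
  rw [continuous_iff_continuousAt]
  intro l₀
  apply continuousAt_of_dominated (bound := fun z => |k z.1|)
  · exact Eventually.of_forall fun l => ((measurable_threshold hk hA l).mul
      (hk.measurable.comp measurable_fst)).aestronglyMeasurable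
  · refine Eventually.of_forall fun l => Eventually.of_forall fun z => ?_
    rw [norm_mul, Real.norm_eq_abs, Real.norm_eq_abs, abs_of_nonneg (threshold_mem l z).1]
    exact mul_le_of_le_one_left (abs_nonneg _) (threshold_mem l z).2
  · exact Continuous.integrableOn_coverable (by fun_prop)
  · have hnull : ∀ᵐ z ∂(volume.restrict (coverable a c bb p)), excess bb k A l₀ z ≠ 0 := by
      rw [ae_restrict_iff' measurableSet_coverable, ae_iff, Measure.volume_eq_prod]
      apply Measure.measure_prod_null_of_ae_null
      · have : {z | ¬(z ∈ coverable a c bb p → excess bb k A l₀ z ≠ 0)} =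
            coverable a c bb p ∩ excess bb k A l₀ ⁻¹' {0} := by
          ext z
          simp
        rw [this]
        exact measurableSet_coverable.inter
          ((continuous_excess hk hA l₀).measurable (measurableSet_singleton 0))
      · refine Eventually.of_forall fun θ => Set.Subsingleton.measure_zero ?_ _
        intro x hx y hy
        simp only [mem_preimage, mem_ofPred_eq, Classical.not_imp, not_not] at hx hy
        have hx1 : x ∈ Ico 0 bb := ⟨hx.1.2.1.le, hx.1.2.2.trans_le (min_le_right _ _)⟩
        have hy1 : y ∈ Ico 0 bb := ⟨hy.1.2.1.le, hy.1.2.2.trans_le (min_le_right _ _)⟩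
        apply (hAmono θ (Ioc_subset_Icc_self hx.1.1)).injOn hx1 hy1
        have h1 := hx.2
        have h2 := hy.2
        simp only [excess] at h1 h2
        simp only
        linarith
    filter_upwards [hnull] with z hz
    have hcont : Continuous fun l => excess bb k A l z := by
      unfold excess
      fun_prop
    apply ContinuousAt.mul _ continuousAt_const
    rcases lt_or_gt_of_ne hz with h | h
    · apply (continuousAt_const (y := (0 : ℝ))).congr
      filter_upwards [hcont.continuousAt.eventually_lt continuousAt_const h] with l hl
      simp [threshold, hl]
    · apply (continuousAt_const (y := (1 : ℝ))).congr
      filter_upwards [continuousAt_const.eventually_lt hcont.continuousAt h] with l hl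
      simp [threshold, hl.le]

/-- At prices between the two extreme ones some threshold allocation clears the market. -/
theorem exists_threshold_clears (hac : a ≤ c) (hbb : 0 < bb) (hk : Continuous k)
    (hA : Continuous fun z : ℝ × ℝ => A z.1 z.2) (hkpos : ∀ θ ∈ Icc a c, 0 < k θ)
    (hAanti : ∀ θ ∈ Icc a c, AntitoneOn (A θ) (Ici 0))
    (hA0 : ∀ θ ∈ Icc a c, ∀ b, bb ≤ b → A θ b = 0)
    (hAmono : ∀ θ ∈ Icc a c, StrictMonoOn (fun b => A θ b + 2 * b * k θ) (Ico 0 bb))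
    (hp : 0 ≤ p) (hpu : (∫ θ in a..c, k θ) * bb ≤ (s + ∫ θ in a..c, k θ) * p) (hs : 0 ≤ s)
    (hpv : s * p ≤ (∫ θ in a..c, k θ) * bb) :
    ∃ l ∈ Icc (-bb) bb, ∫ z in coverable a c bb p, threshold bb k A l z * k z.1 =
      s * p - (∫ θ in a..c, k θ) * max (bb - p) 0 := by
  set K := ∫ θ in a..c, k θ with hK
  have hmem : ∀ z ∈ coverable a c bb p, z.1 ∈ Icc a c ∧ 0 < z.2 ∧ z.2 < bb := fun z hz =>
    ⟨Ioc_subset_Icc_self hz.1, hz.2.1, hz.2.2.trans_le (min_le_right _ _)⟩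
  -- At `l = -bb` the excess is `A + 2 * b * k`, and `A ≥ 0` because it decreases to zero at `bb`:
  -- all are covered.
  have hlo : ∫ z in coverable a c bb p, threshold bb k A (-bb) z * k z.1 = K * min p bb := by
    rw [setIntegral_congr_fun (g := fun z => k z.1) measurableSet_coverable,
      setIntegral_coverable_fst hac hbb hp hk]
    intro z hz
    obtain ⟨h1, h2, h3⟩ := hmem z hz
    have h4 := hAanti z.1 h1 h2.le hbb.le h3.le
    rw [hA0 z.1 h1 bb le_rfl] at h4
    have h5 : 0 ≤ excess bb k A (-bb) z := by
      have := mul_pos h2 (hkpos z.1 h1)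
      unfold excess
      linarith
    simp [threshold, h5]
  -- At `l = bb` the excess is negative, as `A + 2 * b * k` increases strictly towards `2 * bb * k`:
  -- nobody is covered.
  have hhi : ∫ z in coverable a c bb p, threshold bb k A bb z * k z.1 = 0 := by
    rw [setIntegral_congr_fun (g := fun _ => (0 : ℝ)) measurableSet_coverable]
    · simp
    · intro z hz
      obtain ⟨h1, h2, h3⟩ := hmem z hz
      -- Monotonicity excludes `bb` itself, so an intermediate point keeps the inequality strict in
      -- the limit.
      obtain ⟨b', hb1, hb2⟩ := exists_between h3
      have hlim : Tendsto (fun b => A z.1 b + 2 * b * k z.1) (𝓝[<] bb)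
          (𝓝 (A z.1 bb + 2 * bb * k z.1)) := by
        apply Tendsto.mono_left _ nhdsWithin_le_nhds
        have : Continuous fun b => A z.1 b :=
          hA.comp (by fun_prop : Continuous fun b : ℝ => (z.1, b))
        exact (by fun_prop : Continuous fun b => A z.1 b + 2 * b * k z.1).tendsto bb
      have hle : A z.1 b' + 2 * b' * k z.1 ≤ A z.1 bb + 2 * bb * k z.1 := by
        apply ge_of_tendsto hlim
        filter_upwards [Ioo_mem_nhdsLT hb2] with b hb
        exact ((hAmono z.1 h1) ⟨(h2.trans hb1).le, hb2⟩
          ⟨(h2.trans (hb1.trans hb.1)).le, hb.2⟩ hb.1).le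
      have hlt := (hAmono z.1 h1) ⟨h2.le, h3⟩ ⟨(h2.trans hb1).le, hb2⟩ hb1
      simp only at hlt
      rw [hA0 z.1 h1 bb le_rfl] at hle
      have h5 : excess bb k A bb z < 0 := by
        unfold excess
        linarith
      simp [threshold, h5]
  have hK0 : 0 ≤ K := intervalIntegral.integral_nonneg hac fun θ hθ => (hkpos θ hθ).le
  have hivt := intermediate_value_Icc' (by linarith : -bb ≤ bb)
    (continuous_setIntegral_threshold (a := a) (c := c) (p := p) hk hA hAmono).continuousOn
  rw [hlo, hhi] at hivt
  refine hivt ⟨?_, ?_⟩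
  · rcases le_total p bb with h | h
    · rw [max_eq_left (by linarith)]
      linarith
    · rw [max_eq_right (by linarith)]
      have := mul_nonneg hs hp
      linarith
  · rcases le_total p bb with h | h
    · rw [max_eq_left (by linarith), min_eq_left h]
      linarith
    · rw [max_eq_right (by linarith), min_eq_right h]
      linarith

end Duality

/-! ### Reduction of the market to the continuous data `weight` and `virtual`. -/

namespace InsuranceMarket

variable {M : InsuranceMarket} {bb : ℝ}

theorem IsRegular.left_mem (hM : M.IsRegular) : M.θlo ∈ M.Θ := left_mem_Icc.2 hM.θ_lt.le

theorem IsRegular.zero_mem (hM : M.IsRegular) : (0 : ℝ) ∈ M.B :=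
  ⟨le_rfl, by simpa using hM.bbar_pos⟩

theorem B_eq (hbar : M.bbar = (bb : EReal)) : M.B = Ico 0 bb := by
  ext b
  simp [B, hbar]

/-- If the distribution functions of valuations are affine then valuations are bounded. -/
theorem IsRegular.exists_bbar_eq (hM : M.IsRegular) (hH : ∀ θ ∈ M.Θ, IsAffineOn (M.H θ) M.B) :
    ∃ bb : ℝ, 0 < bb ∧ M.bbar = (bb : EReal) := by
  have hbot : M.bbar ≠ ⊥ := (bot_lt_iff_ne_bot.1 (bot_le.trans_lt hM.bbar_pos))
  by_cases hb : M.bbar = ⊤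
  · have hB : M.B = Ici 0 := by
      ext b
      simp only [B, hb, mem_ofPred_eq, mem_Ici, and_iff_left_iff_imp]
      exact fun _ => EReal.coe_lt_top b
    obtain ⟨a, c, hac⟩ := hH _ hM.left_mem
    have hd : M.h M.θlo 0 = c := by
      unfold h
      rw [derivWithin_congr (f := fun t => a + c * t) (fun t ht => hac t ht) (hac 0 hM.zero_mem), hB]
      apply HasDerivWithinAt.derivWithin _ (uniqueDiffOn_Ici 0 0 (by simp))
      simpa using (((hasDerivAt_id (0 : ℝ)).const_mul c).const_add a).hasDerivWithinAt
    have hc : 0 < c := hd ▸ hM.h_pos _ hM.left_mem 0 hM.zero_mem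
    have h0 := (hM.H_mem _ hM.left_mem 0 hM.zero_mem).1
    rw [hac 0 hM.zero_mem] at h0
    -- On an unbounded `B`, positive slope `c` would give `H` a value of at least `2` here.
    have ht : 2 / c ∈ M.B := by
      rw [hB]
      exact (div_pos two_pos hc).le
    have h1 := (hM.H_mem _ hM.left_mem _ ht).2
    rw [hac _ ht, mul_div_cancel₀ _ hc.ne'] at h1
    linarith
  · have hcoe := EReal.coe_toReal hb hbot
    refine ⟨M.bbar.toReal, ?_, hcoe.symm⟩
    have h := hM.bbar_pos
    rw [← hcoe] at h
    exact_mod_cast h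

/-- Density of valuations of type `θ` when it does not depend on the valuation. -/
noncomputable def density (M : InsuranceMarket) (bb θ : ℝ) : ℝ := (1 - M.H θ 0) / bb

/-- Total mass one makes the affine function tend to `1` at `bb`, so its slope is fixed by its value
at `0`, where an atom is allowed. -/
theorem IsRegular.affine_form (hM : M.IsRegular) (hH : ∀ θ ∈ M.Θ, IsAffineOn (M.H θ) M.B)
    (hbb : 0 < bb) (hbar : M.bbar = (bb : EReal)) {θ : ℝ} (hθ : θ ∈ M.Θ) :
    ∀ b ∈ M.B, M.H θ b = 1 - M.density bb θ * (bb - b) := by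
  obtain ⟨a, c, hac⟩ := hH θ hθ
  have hB := B_eq hbar
  have h0 : M.H θ 0 = a := by simpa using hac 0 hM.zero_mem
  have hlub := hM.H_sup θ hθ
  have hd : M.h θ 0 = c := by
    unfold h
    rw [derivWithin_congr (f := fun t => a + c * t) (fun t ht => hac t ht) (hac 0 hM.zero_mem), hB]
    apply HasDerivWithinAt.derivWithin _ (uniqueDiffOn_Ico 0 bb 0 (by simpa using hbb))
    simpa using (((hasDerivAt_id (0 : ℝ)).const_mul c).const_add a).hasDerivWithinAt
  have hc : 0 < c := hd ▸ hM.h_pos θ hθ 0 hM.zero_mem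
  have hle : 1 ≤ a + c * bb := by
    apply hlub.2
    rintro _ ⟨b, hb, rfl⟩
    rw [hac b hb]
    rw [hB] at hb
    nlinarith [hb.2]
  have hge : a + c * bb ≤ 1 := by
    have hlim : Tendsto (fun b => a + c * b) (𝓝[<] bb) (𝓝 (a + c * bb)) :=
      ((by fun_prop : Continuous fun b : ℝ => a + c * b).tendsto bb).mono_left nhdsWithin_le_nhds
    apply le_of_tendsto hlim
    filter_upwards [Ioo_mem_nhdsLT hbb] with b hb
    have hb' : b ∈ M.B := hB ▸ Ioo_subset_Ico_self hb
    rw [← hac b hb']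
    exact (hM.H_mem θ hθ b hb').2
  have hk : M.density bb θ = c := by
    unfold density
    rw [h0]
    field_simp
    linarith
  intro b hb
  rw [hac b hb, hk]
  linarith

theorem IsRegular.h_eq (hM : M.IsRegular) (hH : ∀ θ ∈ M.Θ, IsAffineOn (M.H θ) M.B)
    (hbb : 0 < bb) (hbar : M.bbar = (bb : EReal)) {θ b : ℝ} (hθ : θ ∈ M.Θ) (hb : b ∈ M.B) :
    M.h θ b = M.density bb θ := by
  have hB := B_eq hbar
  have hform := hM.affine_form hH hbb hbar hθ
  unfold h
  rw [derivWithin_congr (f := fun t => 1 - M.density bb θ * (bb - t)) hform (hform b hb)]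
  rw [hB] at hb ⊢
  apply HasDerivWithinAt.derivWithin _ (uniqueDiffOn_Ico 0 bb b hb)
  simpa using ((((hasDerivAt_id b).const_sub bb).const_mul (M.density bb θ)).const_sub
    1).hasDerivWithinAt

theorem IsRegular.density_pos (hM : M.IsRegular) (hH : ∀ θ ∈ M.Θ, IsAffineOn (M.H θ) M.B)
    (hbb : 0 < bb) (hbar : M.bbar = (bb : EReal)) {θ : ℝ} (hθ : θ ∈ M.Θ) :
    0 < M.density bb θ :=
  hM.h_eq hH hbb hbar hθ hM.zero_mem ▸ hM.h_pos θ hθ 0 hM.zero_mem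

theorem IsRegular.density_mul_le (hM : M.IsRegular) (hbb : 0 < bb) {θ : ℝ} (hθ : θ ∈ M.Θ) :
    M.density bb θ * bb ≤ 1 := by
  unfold density
  rw [div_mul_cancel₀ _ hbb.ne']
  linarith [(hM.H_mem θ hθ 0 hM.zero_mem).1]

theorem IsRegular.one_sub_H (hM : M.IsRegular) (hH : ∀ θ ∈ M.Θ, IsAffineOn (M.H θ) M.B)
    (hbb : 0 < bb) (hbar : M.bbar = (bb : EReal)) {θ p : ℝ} (hθ : θ ∈ M.Θ) (hp : 0 ≤ p) :
    1 - M.H θ p = M.density bb θ * max (bb - p) 0 := by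
  rcases lt_or_ge p bb with h | h
  · rw [hM.affine_form hH hbb hbar hθ p (by rw [B_eq hbar]; exact ⟨hp, h⟩),
      max_eq_left (by linarith)]
    ring
  · rw [hM.H_right θ hθ p (by rw [hbar]; exact_mod_cast h), max_eq_right (by linarith)]
    ring

theorem IsRegular.contDiffOn_density (hM : M.IsRegular) :
    ContDiffOn ℝ 1 (M.density bb) M.Θ :=
  (contDiffOn_const.sub (hM.H_smooth_θ 0 hM.zero_mem)).div_const bb

theorem IsRegular.uniqueDiffOn (hM : M.IsRegular) : UniqueDiffOn ℝ M.Θ :=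
  uniqueDiffOn_Icc hM.θ_lt

theorem IsRegular.dHdθ_eq (hM : M.IsRegular) (hH : ∀ θ ∈ M.Θ, IsAffineOn (M.H θ) M.B)
    (hbb : 0 < bb) (hbar : M.bbar = (bb : EReal)) {θ b : ℝ} (hθ : θ ∈ M.Θ) (hb : b ∈ M.B) :
    M.dHdθ θ b = -(derivWithin (M.density bb) M.Θ θ * (bb - b)) := by
  have hform : ∀ t ∈ M.Θ, M.H t b = 1 - M.density bb t * (bb - b) :=
    fun t ht => hM.affine_form hH hbb hbar ht b hb
  unfold dHdθ
  rw [derivWithin_congr (f := fun t => 1 - M.density bb t * (bb - b)) hform (hform θ hθ)]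
  have hd := ((hM.contDiffOn_density (bb := bb)).differentiableOn one_ne_zero θ hθ).hasDerivWithinAt
  exact ((hd.mul_const (bb - b)).const_sub 1).derivWithin (hM.uniqueDiffOn θ hθ)

/-- Projection of the real line onto the set of risk types. -/
noncomputable def proj (hM : M.IsRegular) (θ : ℝ) : ℝ := projIcc M.θlo M.θhi hM.θ_lt.le θ

theorem proj_mem (hM : M.IsRegular) (θ : ℝ) : proj hM θ ∈ M.Θ := Subtype.prop _

theorem proj_eq (hM : M.IsRegular) {θ : ℝ} (hθ : θ ∈ M.Θ) : proj hM θ = θ := by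
  simp [proj, projIcc_of_mem _ hθ]

theorem continuous_proj (hM : M.IsRegular) : Continuous (proj hM) :=
  continuous_subtype_val.comp continuous_projIcc

/-- Joint density of types and valuations. -/
noncomputable def weight (hM : M.IsRegular) (bb θ : ℝ) : ℝ :=
  M.density bb (proj hM θ) * M.f (proj hM θ)

/-- Period-1 virtual value times the density of types, continuously extended. -/
noncomputable def virtual (hM : M.IsRegular) (bb θ b : ℝ) : ℝ :=
  M.f (proj hM θ) * (1 - M.g (1 - M.density bb (proj hM θ) * min (max (bb - b) 0) bb)) -
    (1 - M.F (proj hM θ)) * M.g' (1 - M.density bb (proj hM θ) * min (max (bb - b) 0) bb) *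
      derivWithin (M.density bb) M.Θ (proj hM θ) * min (max (bb - b) 0) bb

theorem continuous_weight (hM : M.IsRegular) : Continuous (weight hM bb) :=
  ((hM.contDiffOn_density.continuousOn.mul hM.f_cont).comp_continuous (continuous_proj hM)
    (proj_mem hM))

theorem weight_pos (hM : M.IsRegular) (hH : ∀ θ ∈ M.Θ, IsAffineOn (M.H θ) M.B)
    (hbb : 0 < bb) (hbar : M.bbar = (bb : EReal)) (θ : ℝ) : 0 < weight hM bb θ :=
  mul_pos (hM.density_pos hH hbb hbar (proj_mem hM θ)) (hM.f_pos _ (proj_mem hM θ))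

theorem IsRegular.continuousOn_F (hM : M.IsRegular) : ContinuousOn M.F M.Θ := by
  have h := intervalIntegral.continuousOn_primitive_interval (μ := volume) (f := M.f)
    (a := M.θlo) (b := M.θhi)
    (by rw [uIcc_of_le hM.θ_lt.le]; exact hM.f_cont.integrableOn_compact isCompact_Icc)
  rwa [uIcc_of_le hM.θ_lt.le] at h

/-- Projecting the type and clamping `bb - b` to `[0, bb]` keep the arguments of `g` and `g'` in
`[0, 1]`, where both are continuous. -/
theorem continuous_virtual (hM : M.IsRegular) (hH : ∀ θ ∈ M.Θ, IsAffineOn (M.H θ) M.B)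
    (hbb : 0 < bb) (hbar : M.bbar = (bb : EReal)) :
    Continuous fun z : ℝ × ℝ => virtual hM bb z.1 z.2 := by
  have hp : Continuous fun z : ℝ × ℝ => proj hM z.1 := (continuous_proj hM).comp continuous_fst
  have hpm : ∀ z : ℝ × ℝ, proj hM z.1 ∈ M.Θ := fun z => proj_mem hM z.1
  have hd := (hM.contDiffOn_density (bb := bb)).continuousOn.comp_continuous hp hpm
  have hd' := ((hM.contDiffOn_density (bb := bb)).continuousOn_derivWithin hM.uniqueDiffOn
    le_rfl).comp_continuous hp hpm
  have hf := hM.f_cont.comp_continuous hp hpm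
  have hF := hM.continuousOn_F.comp_continuous hp hpm
  have hq : Continuous fun z : ℝ × ℝ =>
      1 - M.density bb (proj hM z.1) * min (max (bb - z.2) 0) bb := by fun_prop
  have hqm : ∀ z : ℝ × ℝ,
      1 - M.density bb (proj hM z.1) * min (max (bb - z.2) 0) bb ∈ Icc (0 : ℝ) 1 := by
    intro z
    have h1 := hM.density_pos hH hbb hbar (hpm z)
    have h2 := hM.density_mul_le hbb (hpm z)
    have h3 : 0 ≤ min (max (bb - z.2) 0) bb := le_min (le_max_right _ _) hbb.le
    have h4 := mul_le_mul_of_nonneg_left (min_le_right (max (bb - z.2) 0) bb) h1.le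
    have h5 := mul_nonneg h1.le h3
    constructor <;> linarith
  have hg := hM.g_smooth.continuousOn.comp_continuous hq hqm
  have hg' : Continuous fun z : ℝ × ℝ =>
      M.g' (1 - M.density bb (proj hM z.1) * min (max (bb - z.2) 0) bb) :=
    (hM.g_smooth.continuousOn_derivWithin (uniqueDiffOn_Icc zero_lt_one)
      le_rfl).comp_continuous hq hqm
  unfold virtual
  fun_prop

theorem virtual_eq_zero (hM : M.IsRegular) (hbb : 0 < bb) (θ : ℝ) {b : ℝ} (hb : bb ≤ b) :
    virtual hM bb θ b = 0 := by
  have : min (max (bb - b) 0) bb = 0 := by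
    rw [max_eq_right (by linarith), min_eq_left hbb.le]
  simp [virtual, this, hM.g_one]

theorem virtual_eq (hM : M.IsRegular) (hH : ∀ θ ∈ M.Θ, IsAffineOn (M.H θ) M.B)
    (hbb : 0 < bb) (hbar : M.bbar = (bb : EReal)) {θ b : ℝ} (hθ : θ ∈ M.Θ) (hb : b ∈ M.B) :
    virtual hM bb θ b = M.J₁ θ b * M.f θ := by
  have hfpos := (hM.f_pos θ hθ).ne'
  have hu : min (max (bb - b) 0) bb = bb - b := by
    have hb' := hb
    rw [B_eq hbar] at hb'
    rw [max_eq_left (by linarith [hb'.2]), min_eq_left (by linarith [hb'.1])]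
  unfold virtual J₁
  rw [proj_eq hM hθ, hu, hM.dHdθ_eq hH hbb hbar hθ hb, hM.affine_form hH hbb hbar hθ b hb]
  field_simp
  ring

theorem virtual_antitoneOn (hM : M.IsRegular) (hH : ∀ θ ∈ M.Θ, IsAffineOn (M.H θ) M.B)
    (hJ₁ : ∀ θ ∈ M.Θ, AntitoneOn (M.J₁ θ) M.B) (hbb : 0 < bb) (hbar : M.bbar = (bb : EReal))
    {θ : ℝ} (hθ : θ ∈ M.Θ) : AntitoneOn (virtual hM bb θ) (Ici 0) := by
  have hB := B_eq hbar
  have hanti : ∀ x y, 0 ≤ x → x ≤ y → y < bb → virtual hM bb θ y ≤ virtual hM bb θ x := by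
    intro x y hx hxy hy
    have hx' : x ∈ M.B := hB ▸ ⟨hx, hxy.trans_lt hy⟩
    have hy' : y ∈ M.B := hB ▸ ⟨hx.trans hxy, hy⟩
    rw [virtual_eq hM hH hbb hbar hθ hx', virtual_eq hM hH hbb hbar hθ hy']
    exact mul_le_mul_of_nonneg_right (hJ₁ θ hθ hx' hy' hxy) (hM.f_pos θ hθ).le
  intro x hx y _ hxy
  rw [mem_Ici] at hx
  rcases lt_or_ge y bb with h | h
  · exact hanti x y hx hxy h
  rw [virtual_eq_zero hM hbb θ h]
  rcases lt_or_ge x bb with h' | h'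
  · have hc : Continuous fun b => virtual hM bb θ b :=
      (continuous_virtual hM hH hbb hbar).comp (by fun_prop : Continuous fun b : ℝ => (θ, b))
    have hlim : Tendsto (fun b => virtual hM bb θ b) (𝓝[<] bb) (𝓝 0) := by
      rw [← virtual_eq_zero hM hbb θ le_rfl]
      exact (hc.tendsto bb).mono_left nhdsWithin_le_nhds
    apply le_of_tendsto hlim
    filter_upwards [Ioo_mem_nhdsLT h'] with b hb
    exact hanti x b hx hb.1.le hb.2
  · rw [virtual_eq_zero hM hbb θ h']

/-- The inverse hazard rate of an affine distribution is `bb - b`, which turns `b - p - (bb - b)`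
into `2 * b - bb - p`: the price enters exactly as a multiplier does. -/
theorem J_mul_h_mul_f (hM : M.IsRegular) (hH : ∀ θ ∈ M.Θ, IsAffineOn (M.H θ) M.B)
    (hbb : 0 < bb) (hbar : M.bbar = (bb : EReal)) {θ b : ℝ} (hθ : θ ∈ M.Θ) (hb : b ∈ M.B)
    (p : ℝ) : M.J p θ b * M.h θ b * M.f θ =
      excess bb (weight hM bb) (virtual hM bb) p (θ, b) := by
  have hd := (hM.density_pos hH hbb hbar hθ).ne'
  unfold excess J weight
  rw [virtual_eq hM hH hbb hbar hθ hb, proj_eq hM hθ, hM.h_eq hH hbb hbar hθ hb,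
    hM.affine_form hH hbb hbar hθ b hb]
  field_simp
  ring

theorem virtual_add_strictMonoOn (hM : M.IsRegular) (hH : ∀ θ ∈ M.Θ, IsAffineOn (M.H θ) M.B)
    (hJ : ∀ p : ℝ, 0 ≤ p → ∀ θ ∈ M.Θ, StrictMonoOn (M.J p θ) M.B) (hbb : 0 < bb)
    (hbar : M.bbar = (bb : EReal)) {θ : ℝ} (hθ : θ ∈ M.Θ) :
    StrictMonoOn (fun b => virtual hM bb θ b + 2 * b * weight hM bb θ) (Ico 0 bb) := by
  rw [← B_eq hbar]
  intro x hx y hy hxy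
  have h1 := J_mul_h_mul_f hM hH hbb hbar hθ hx 0
  have h2 := J_mul_h_mul_f hM hH hbb hbar hθ hy 0
  have h3 := mul_lt_mul_of_pos_right (mul_lt_mul_of_pos_right (hJ 0 le_rfl θ hθ hx hy hxy)
    (hM.density_pos hH hbb hbar hθ)) (hM.f_pos θ hθ)
  rw [hM.h_eq hH hbb hbar hθ hx] at h1
  rw [hM.h_eq hH hbb hbar hθ hy] at h2
  rw [h1, h2] at h3
  simp only [excess] at h3
  simp only
  linarith

/-! ### Demand and objective as integrals over coverable agents. -/

theorem setIntegral_B_inter (hbar : M.bbar = (bb : EReal)) {p : ℝ} (w : ℝ → ℝ) :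
    ∫ b in M.B ∩ Icc 0 p, w b = ∫ b in Ioo 0 (min p bb), w b := by
  apply setIntegral_congr_set
  rw [B_eq hbar]
  have h1 : Ico 0 bb ∩ Icc 0 p ⊆ Icc 0 (min p bb) :=
    fun b hb => ⟨hb.2.1, le_min hb.2.2 hb.1.2.le⟩
  have h2 : Ioo 0 (min p bb) ⊆ Ico 0 bb ∩ Icc 0 p := fun b hb =>
    ⟨⟨hb.1.le, hb.2.trans_le (min_le_right _ _)⟩, hb.1.le, (hb.2.trans_le (min_le_left _ _)).le⟩
  exact (h1.eventuallyLE.trans Ioo_ae_eq_Icc.symm.le).antisymm h2.eventuallyLE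

theorem coverable_subset (hbar : M.bbar = (bb : EReal)) {p : ℝ} :
    coverable M.θlo M.θhi bb p ⊆ M.Θ ×ˢ M.B := by
  rw [B_eq hbar]
  exact prod_mono Ioc_subset_Icc_self
    fun b hb => ⟨hb.1.le, hb.2.trans_le (min_le_right _ _)⟩

theorem iteratedIntegral_eq (hM : M.IsRegular) (hbar : M.bbar = (bb : EReal)) {p : ℝ}
    {y : ℝ → ℝ → ℝ} {w : ℝ × ℝ → ℝ} (hw : IntegrableOn w (coverable M.θlo M.θhi bb p))
    (hyw : ∀ θ ∈ M.Θ, ∀ b ∈ M.B, y θ b * M.f θ = w (θ, b)) :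
    ∫ θ in M.θlo..M.θhi, (∫ b in M.B ∩ Icc 0 p, y θ b) * M.f θ =
      ∫ z in coverable M.θlo M.θhi bb p, w z := by
  rw [setIntegral_coverable hM.θ_lt.le hw]
  apply intervalIntegral.integral_congr
  intro θ hθ
  rw [uIcc_of_le hM.θ_lt.le] at hθ
  simp only
  rw [setIntegral_B_inter hbar, ← integral_mul_const]
  apply setIntegral_congr_fun measurableSet_Ioo
  intro b hb
  exact hyw θ hθ b (by
    rw [B_eq hbar]
    exact ⟨hb.1.le, hb.2.trans_le (min_le_right _ _)⟩)

theorem insuredDemand_eq (hM : M.IsRegular) (hH : ∀ θ ∈ M.Θ, IsAffineOn (M.H θ) M.B)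
    (hbb : 0 < bb) (hbar : M.bbar = (bb : EReal)) {p : ℝ} {x : ℝ → ℝ → ℝ}
    (hx : Measurable fun z : ℝ × ℝ => x z.1 z.2)
    (hx01 : ∀ θ ∈ M.Θ, ∀ b ∈ M.B, x θ b ∈ Icc (0 : ℝ) 1) :
    M.insuredDemand x p =
      ∫ z in coverable M.θlo M.θhi bb p, x z.1 z.2 * weight hM bb z.1 := by
  apply iteratedIntegral_eq hM hbar
    (integrableOn_coverable_mul ((continuous_weight hM).comp continuous_fst) hx
      fun z hz => hx01 _ (coverable_subset hbar hz).1 _ (coverable_subset hbar hz).2)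
  intro θ hθ b hb
  simp only [weight, Function.comp_apply, hM.h_eq hH hbb hbar hθ hb, proj_eq hM hθ]
  ring

theorem objective_eq (hM : M.IsRegular) (hβ : M.β = 0)
    (hH : ∀ θ ∈ M.Θ, IsAffineOn (M.H θ) M.B)
    (hbb : 0 < bb) (hbar : M.bbar = (bb : EReal)) {p : ℝ} {x : ℝ → ℝ → ℝ}
    (hx : Measurable fun z : ℝ × ℝ => x z.1 z.2)
    (hx01 : ∀ θ ∈ M.Θ, ∀ b ∈ M.B, x θ b ∈ Icc (0 : ℝ) 1) :
    M.objective p x = ∫ z in coverable M.θlo M.θhi bb p,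
      x z.1 z.2 * excess bb (weight hM bb) (virtual hM bb) p z := by
  have hK : M.K p = 0 := by simp [K, UNP, hβ]
  rw [objective, hK, add_zero]
  apply iteratedIntegral_eq hM hbar
    (integrableOn_coverable_mul
      (continuous_excess (continuous_weight hM) (continuous_virtual hM hH hbb hbar) p) hx
      fun z hz => hx01 _ (coverable_subset hbar hz).1 _ (coverable_subset hbar hz).2)
  intro θ hθ b hb
  rw [← J_mul_h_mul_f hM hH hbb hbar hθ hb]
  ring

theorem directDemand_eq (hM : M.IsRegular) (hH : ∀ θ ∈ M.Θ, IsAffineOn (M.H θ) M.B)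
    (hbb : 0 < bb) (hbar : M.bbar = (bb : EReal)) {p : ℝ} (hp : 0 ≤ p) :
    M.directDemand p = (∫ θ in M.θlo..M.θhi, weight hM bb θ) * max (bb - p) 0 := by
  rw [directDemand, ← intervalIntegral.integral_mul_const]
  apply intervalIntegral.integral_congr
  intro θ hθ
  rw [uIcc_of_le hM.θ_lt.le] at hθ
  simp only
  rw [hM.one_sub_H hH hbb hbar hθ hp, weight, proj_eq hM hθ]
  ring

/-! ### The extreme prices and strong duality for the market. -/

theorem IsRegular.exists_supply_slope (hM : M.IsRegular) (hS : IsAffineOn M.S (Ici 0)) :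
    ∃ s : ℝ, 0 < s ∧ ∀ p, 0 ≤ p → M.S p = s * p := by
  obtain ⟨a, s, h⟩ := hS
  have h0 := h 0 (by simp)
  have h1 := h 1 (by simp)
  have hlt := hM.S_strictMono (by simp) (by simp) (zero_lt_one (α := ℝ))
  rw [hM.S_zero] at h0
  rw [h1, hM.S_zero] at hlt
  refine ⟨s, by linarith, fun p hp => ?_⟩
  rw [h p hp]
  linarith

theorem isNoCoveragePrice_iff (hM : M.IsRegular) (hH : ∀ θ ∈ M.Θ, IsAffineOn (M.H θ) M.B)
    (hbb : 0 < bb) (hbar : M.bbar = (bb : EReal)) {s : ℝ} (hs : 0 < s)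
    (hS : ∀ p, 0 ≤ p → M.S p = s * p) {p : ℝ} : M.IsNoCoveragePrice p ↔
      p = (∫ θ in M.θlo..M.θhi, weight hM bb θ) * bb /
        (s + ∫ θ in M.θlo..M.θhi, weight hM bb θ) := by
  have hKpos : 0 < ∫ θ in M.θlo..M.θhi, weight hM bb θ :=
    intervalIntegral.intervalIntegral_pos_of_pos
      ((continuous_weight hM).intervalIntegrable _ _) (weight_pos hM hH hbb hbar) hM.θ_lt
  set K := ∫ θ in M.θlo..M.θhi, weight hM bb θ with hK
  have hdem : ∀ p, 0 ≤ p → M.demand (fun _ _ => 0) p = K * max (bb - p) 0 := by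
    intro p hp
    simp [demand, insuredDemand, directDemand_eq hM hH hbb hbar hp, hK]
  rw [eq_div_iff (by positivity)]
  constructor
  · rintro ⟨hp, h⟩
    rw [hdem p hp.le, hS p hp.le] at h
    rcases le_total p bb with h' | h'
    · rw [max_eq_left (by linarith)] at h
      linarith
    · rw [max_eq_right (by linarith)] at h
      have := mul_pos hs hp
      linarith
  · intro h
    have hp : 0 < p := pos_of_mul_pos_left (h ▸ mul_pos hKpos hbb) (by positivity)
    have hpb : p ≤ bb := by
      by_contra! hlt
      have h1 := mul_lt_mul_of_pos_left hlt hKpos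
      have h2 := mul_pos hs hp
      linarith
    refine ⟨hp, ?_⟩
    rw [hdem p hp.le, hS p hp.le, max_eq_left (by linarith)]
    linarith

/-- Under full coverage every positive valuation is served, so demand does not depend on the price;
the clearing price may exceed `bb`. -/
theorem isFullCoveragePrice_iff (hM : M.IsRegular) (hH : ∀ θ ∈ M.Θ, IsAffineOn (M.H θ) M.B)
    (hbb : 0 < bb) (hbar : M.bbar = (bb : EReal)) {s : ℝ} (hs : 0 < s)
    (hS : ∀ p, 0 ≤ p → M.S p = s * p) {p : ℝ} : M.IsFullCoveragePrice p ↔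
      p = (∫ θ in M.θlo..M.θhi, weight hM bb θ) * bb / s := by
  have hKpos : 0 < ∫ θ in M.θlo..M.θhi, weight hM bb θ :=
    intervalIntegral.intervalIntegral_pos_of_pos
      ((continuous_weight hM).intervalIntegrable _ _) (weight_pos hM hH hbb hbar) hM.θ_lt
  set K := ∫ θ in M.θlo..M.θhi, weight hM bb θ with hK
  have hdem : ∀ p, 0 ≤ p → M.demand (fun _ _ => 1) p = K * bb := by
    intro p hp
    rw [demand, insuredDemand_eq hM hH hbb hbar measurable_const (fun _ _ _ _ => by simp),
      directDemand_eq hM hH hbb hbar hp]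
    simp only [one_mul]
    rw [setIntegral_coverable_fst hM.θ_lt.le hbb hp (continuous_weight hM), ← hK, ← mul_add]
    rcases le_total p bb with h | h
    · rw [max_eq_left (by linarith), min_eq_left h]
      ring
    · rw [max_eq_right (by linarith), min_eq_right h]
      ring
  rw [eq_div_iff hs.ne']
  constructor
  · rintro ⟨hp, h⟩
    rw [hdem p hp.le, hS p hp.le] at h
    linarith
  · intro h
    have hp : 0 < p := pos_of_mul_pos_left (h ▸ mul_pos hKpos hbb) hs.le
    refine ⟨hp, ?_⟩
    rw [hdem p hp.le, hS p hp.le]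
    linarith

/-- Strong duality: at prices between the extreme ones the profit is attained, and is the minimum
of the dual function. -/
theorem isGreatest_profitValues (hM : M.IsRegular) (hβ : M.β = 0)
    (hJ : ∀ p : ℝ, 0 ≤ p → ∀ θ ∈ M.Θ, StrictMonoOn (M.J p θ) M.B)
    (hJ₁ : ∀ θ ∈ M.Θ, AntitoneOn (M.J₁ θ) M.B)
    (hH : ∀ θ ∈ M.Θ, IsAffineOn (M.H θ) M.B)
    (hbb : 0 < bb) (hbar : M.bbar = (bb : EReal)) {s : ℝ} (hs : 0 < s)
    (hS : ∀ p, 0 ≤ p → M.S p = s * p) {p : ℝ} (hp : 0 ≤ p)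
    (hpu : (∫ θ in M.θlo..M.θhi, weight hM bb θ) * bb ≤
      (s + ∫ θ in M.θlo..M.θhi, weight hM bb θ) * p)
    (hpv : s * p ≤ (∫ θ in M.θlo..M.θhi, weight hM bb θ) * bb) :
    IsGreatest (M.profitValues p) (M.profit p) ∧
      (∀ l ∈ Icc (-bb) bb, M.profit p ≤
        dual M.θlo M.θhi bb s (weight hM bb) (virtual hM bb) p l) ∧
      ∃ l ∈ Icc (-bb) bb, M.profit p =
        dual M.θlo M.θhi bb s (weight hM bb) (virtual hM bb) p l := by
  have hk := continuous_weight hM (bb := bb)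
  have hA := continuous_virtual hM hH hbb hbar
  have hkpos : ∀ θ ∈ Icc M.θlo M.θhi, 0 < weight hM bb θ :=
    fun θ _ => weight_pos hM hH hbb hbar θ
  have hA0 : ∀ θ ∈ Icc M.θlo M.θhi, ∀ b, bb ≤ b → virtual hM bb θ b = 0 :=
    fun θ _ b hb => virtual_eq_zero hM hbb θ hb
  have hAmono : ∀ θ ∈ Icc M.θlo M.θhi,
      StrictMonoOn (fun b => virtual hM bb θ b + 2 * b * weight hM bb θ) (Ico 0 bb) :=
    fun θ hθ => virtual_add_strictMonoOn hM hH hJ hbb hbar hθ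
  have hRS : M.RS p = s * p - (∫ θ in M.θlo..M.θhi, weight hM bb θ) * max (bb - p) 0 := by
    rw [RS, hS p hp, directDemand_eq hM hH hbb hbar hp]
  obtain ⟨l, hl, hclear⟩ := exists_threshold_clears hM.θ_lt.le hbb hk hA hkpos
    (fun θ hθ => virtual_antitoneOn hM hH hJ₁ hbb hbar hθ) hA0 hAmono hp hpu hs.le hpv
  set x : ℝ → ℝ → ℝ := fun θ b => threshold bb (weight hM bb) (virtual hM bb) l (θ, b) with hx
  have hxm : Measurable fun z : ℝ × ℝ => x z.1 z.2 := measurable_threshold hk hA l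
  have hx01 : ∀ θ ∈ M.Θ, ∀ b ∈ M.B, x θ b ∈ Icc (0 : ℝ) 1 := fun θ _ b _ => threshold_mem l _
  have hfeas : M.IsFeasible p x := by
    refine ⟨hxm, hx01, ?_, ?_⟩
    · intro θ hθ b hb b' hb' hbb'
      rw [B_eq hbar] at hb hb'
      have h1 := (hAmono θ hθ).monotoneOn hb hb' hbb'
      have h2 : excess bb (weight hM bb) (virtual hM bb) l (θ, b) ≤
          excess bb (weight hM bb) (virtual hM bb) l (θ, b') := by
        simp only [excess]
        linarith
      simp only [hx, threshold]
      split_ifs with h3 h4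
      · exact le_rfl
      · exact absurd (h3.trans h2) h4
      · exact zero_le_one
      · exact le_rfl
    · rw [insuredDemand_eq hM hH hbb hbar hxm hx01, hRS]
      exact hclear
  have hobj : M.objective p x = dual M.θlo M.θhi bb s (weight hM bb) (virtual hM bb) p l := by
    rw [objective_eq hM hβ hH hbb hbar hxm hx01]
    exact setIntegral_coverable_threshold_eq_dual hM.θ_lt.le hbb hk hA hkpos hA0 hp hl.2 hclear
  have hweak : ∀ l ∈ Icc (-bb) bb, ∀ v ∈ M.profitValues p,
      v ≤ dual M.θlo M.θhi bb s (weight hM bb) (virtual hM bb) p l := by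
    rintro l hl _ ⟨y, hy, rfl⟩
    rw [objective_eq hM hβ hH hbb hbar hy.meas hy.mem]
    apply setIntegral_coverable_le_dual hM.θ_lt.le hbb hk hA hkpos hA0 hp hl.2 hy.meas
      fun z hz => hy.mem _ (coverable_subset hbar hz).1 _ (coverable_subset hbar hz).2
    rw [← hRS, ← hy.eq, insuredDemand_eq hM hH hbb hbar hy.meas hy.mem]
  have hgr : IsGreatest (M.profitValues p)
      (dual M.θlo M.θhi bb s (weight hM bb) (virtual hM bb) p l) :=
    ⟨⟨x, hfeas, hobj.symm⟩, fun v hv => hweak l hl v hv⟩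
  have hprofit : M.profit p = dual M.θlo M.θhi bb s (weight hM bb) (virtual hM bb) p l :=
    hgr.csSup_eq
  rw [hprofit]
  exact ⟨hgr, fun m hm => hweak m hm _ hgr.1, l, hl, rfl⟩

end InsuranceMarket

open InsuranceMarket in
theorem mainTheorem7 (M : InsuranceMarket) (hM : M.IsRegular)
    (hβ : M.β = 0)
    (hJ : ∀ p : ℝ, 0 ≤ p → ∀ θ ∈ M.Θ, StrictMonoOn (M.J p θ) M.B)
    (hJ₁ : ∀ θ ∈ M.Θ, AntitoneOn (M.J₁ θ) M.B)
    (hH : ∀ θ ∈ M.Θ, IsAffineOn (M.H θ) M.B)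
    (hS : IsAffineOn M.S (Set.Ici 0)) :
    (∃! p, M.IsNoCoveragePrice p) ∧ (∃! p, M.IsFullCoveragePrice p) ∧
      ∀ pN pF : ℝ, M.IsNoCoveragePrice pN → M.IsFullCoveragePrice pF →
        pN < pF ∧
        (∀ p ∈ Set.Icc pN pF, IsGreatest (M.profitValues p) (M.profit p)) ∧
        DifferentiableOn ℝ M.profit (Set.Icc pN pF) ∧
        StrictAntiOn (derivWithin M.profit (Set.Icc pN pF)) (Set.Icc pN pF) ∧
        ConcaveOn ℝ (Set.Icc pN pF) M.profit := by
  obtain ⟨bb, hbb, hbar⟩ := hM.exists_bbar_eq hH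
  obtain ⟨s, hs, hS⟩ := hM.exists_supply_slope hS
  have hk := continuous_weight hM (bb := bb)
  have hKpos : 0 < ∫ θ in M.θlo..M.θhi, weight hM bb θ :=
    intervalIntegral.intervalIntegral_pos_of_pos (hk.intervalIntegrable _ _)
      (weight_pos hM hH hbb hbar) hM.θ_lt
  have hN : ∀ p, M.IsNoCoveragePrice p ↔ _ := fun p =>
    isNoCoveragePrice_iff hM hH hbb hbar hs hS
  have hF : ∀ p, M.IsFullCoveragePrice p ↔ _ := fun p =>
    isFullCoveragePrice_iff hM hH hbb hbar hs hS
  refine ⟨⟨_, (hN _).2 rfl, fun p h => (hN p).1 h⟩, ⟨_, (hF _).2 rfl, fun p h => (hF p).1 h⟩, ?_⟩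
  intro pN pF hpN hpF
  have hN0 := hpN.1
  have hNeq := (hN _).1 hpN
  have hFeq := (hF _).1 hpF
  rw [eq_div_iff (by positivity)] at hNeq
  rw [eq_div_iff hs.ne'] at hFeq
  have hlt : pN < pF := by
    have := mul_pos hKpos hN0
    by_contra! hle
    have := mul_le_mul_of_nonneg_right hle hs.le
    linarith
  have hgr : ∀ p ∈ Icc pN pF, _ := fun p hp =>
    isGreatest_profitValues hM hβ hJ hJ₁ hH hbb hbar hs hS (hN0.le.trans hp.1)
      (by rw [← hNeq, mul_comm]; exact mul_le_mul_of_nonneg_left hp.1 (by positivity))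
      (by rw [← hFeq, mul_comm]; exact mul_le_mul_of_nonneg_right hp.2 hs.le)
  refine ⟨hlt, fun p hp => (hgr p hp).1, ?_⟩
  exact differentiableOn_strictAntiOn_concaveOn_of_dual hM.θ_lt hs hk
    (continuous_virtual hM hH hbb hbar) (fun θ _ => weight_pos hM hH hbb hbar θ)
    (fun θ hθ => virtual_antitoneOn hM hH hJ₁ hbb hbar hθ) hN0 hlt (by linarith) (by linarith)
    (fun p hp => (hgr p hp).2.1) (fun p hp => (hgr p hp).2.2)
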